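/- Let $n\ge 2$ and let $(N^{n-1},g_N)$ be a closed (that is, compact and without boundary, not necessarily connected) smooth Riemannian manifold. Then the following two statements are equivalent. (i) For every $\varepsilon>0$ there exist $\delta>0$ and a smooth Riemannian metric on $(-\delta,\delta)\times N$ of the form $g^\varepsilon=dt^2+g^\varepsilon_t$, where $g^\varepsilon_t$, $t\in(-\delta,\delta)$, is a smoothly varying family of Riemannian metrics on $N$, such that - $g^\varepsilon$ has positive Ricci curvature, that is, $\mathrm{Ric}(v,v)>0$ for every nonzero tangent vector $v$ of $(-\delta,\delta)\times N$; - the hypersurface $\{0\}\times N$ is totally geodesic, that is, its second fundamental form with respect to $g^\varepsilon$ vanishes; - $g^\varepsilon_0=g_N$; - $\mathrm{Ric}(\partial_t,\partial_t)=\varepsilon$ at every point of $\{0\}\times N$. (ii) The scalar curvature of $g_N$ is nonnegative at every point of $N$. -/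

import Mathlib

open scoped Manifold ContDiff

set_option maxSynthPendingDepth 3

noncomputable section

namespace CylinderRicci

/-! ## Curvature of a metric given in coordinates

Here `G : E → E →L[ℝ] E →L[ℝ] ℝ` is a metric on (an open part of) a vector space `E`. -/

section Coordinates

variable {E : Type*} [NormedAddCommGroup E] [NormedSpace ℝ E]

/-- Exchange the last two arguments of a continuous trilinear map. -/
def flipLast {F : Type*} [NormedAddCommGroup F] [NormedSpace ℝ F]
    (T : E →L[ℝ] E →L[ℝ] E →L[ℝ] F) : E →L[ℝ] E →L[ℝ] E →L[ℝ] F :=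
  (ContinuousLinearMap.flipₗᵢ ℝ E E F).toContinuousLinearEquiv.toContinuousLinearMap ∘L T

@[simp] theorem flipLast_apply {F : Type*} [NormedAddCommGroup F] [NormedSpace ℝ F]
    (T : E →L[ℝ] E →L[ℝ] E →L[ℝ] F) (u v w : E) : flipLast T u v w = T u w v := rfl

/-- The Christoffel symbols of the first kind,
`(u, v, w) ↦ (∂_u G(v, w) + ∂_v G(u, w) - ∂_w G(u, v)) / 2`. -/
def koszul (G : E → E →L[ℝ] E →L[ℝ] ℝ) (y : E) : E →L[ℝ] E →L[ℝ] E →L[ℝ] ℝ :=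
  (1 / 2 : ℝ) • (fderiv ℝ G y + (fderiv ℝ G y).flip - flipLast (fderiv ℝ G y).flip)

theorem koszul_apply (G : E → E →L[ℝ] E →L[ℝ] ℝ) (y u v w : E) :
    koszul G y u v w =
      (1 / 2 : ℝ) * (fderiv ℝ G y u v w + fderiv ℝ G y v u w - fderiv ℝ G y w u v) := rfl

/-- The Christoffel symbols of the second kind of the metric `G`: `christoffel G y u v` is the
covariant derivative `∇_u v` at `y`, where `v` is extended to a constant vector field, for the
Levi-Civita connection of `G`. It is the vector which represents the linear form `koszul G y u v`
with respect to the scalar product `G y`. -/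
def christoffel (G : E → E →L[ℝ] E →L[ℝ] ℝ) (y : E) : E →L[ℝ] E →L[ℝ] E :=
  ContinuousLinearMap.compL ℝ E (E →L[ℝ] ℝ) E (ContinuousLinearMap.inverse (G y)) ∘L koszul G y

theorem christoffel_apply (G : E → E →L[ℝ] E →L[ℝ] ℝ) (y u v : E) :
    christoffel G y u v = ContinuousLinearMap.inverse (G y) (koszul G y u v) := rfl

/-- The curvature tensor `R(u, v) w = ∇_u ∇_v w - ∇_v ∇_u w - ∇_[u, v] w` of the metric `G`. -/
def curvature (G : E → E →L[ℝ] E →L[ℝ] ℝ) (y : E) : E →L[ℝ] E →L[ℝ] E →L[ℝ] E :=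
  let D := fderiv ℝ (christoffel G) y
  let Q := (ContinuousLinearMap.compL ℝ E E E).bilinearComp (christoffel G y) (christoffel G y)
  D - D.flip + Q - Q.flip

theorem curvature_apply (G : E → E →L[ℝ] E →L[ℝ] ℝ) (y u v w : E) :
    curvature G y u v w =
      fderiv ℝ (christoffel G) y u v w - fderiv ℝ (christoffel G) y v u w
        + christoffel G y u (christoffel G y v w)
        - christoffel G y v (christoffel G y u w) := rfl

variable [FiniteDimensional ℝ E]

/-- The trace of an endomorphism of `E`, as a continuous linear form. -/
def traceL (E : Type*) [NormedAddCommGroup E] [NormedSpace ℝ E] [FiniteDimensional ℝ E] :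
    (E →L[ℝ] E) →L[ℝ] ℝ :=
  LinearMap.toContinuousLinearMap (LinearMap.trace ℝ E ∘ₗ ContinuousLinearMap.coeLM ℝ)

theorem traceL_apply (A : E →L[ℝ] E) : traceL E A = LinearMap.trace ℝ E (A : E →ₗ[ℝ] E) := rfl

/-- The Ricci tensor `Ric(v, w) = tr (u ↦ R(u, v) w)` of the metric `G`. -/
def coordRicci (G : E → E →L[ℝ] E →L[ℝ] ℝ) (y : E) : E →L[ℝ] E →L[ℝ] ℝ :=
  ContinuousLinearMap.compL ℝ E (E →L[ℝ] E) ℝ (traceL E) ∘L flipLast (curvature G y).flip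

theorem coordRicci_apply (G : E → E →L[ℝ] E →L[ℝ] ℝ) (y v w : E) :
    coordRicci G y v w = traceL E (((curvature G y).flip v).flip w) := rfl

/-- The scalar curvature of the metric `G`: the trace with respect to `G y` of the Ricci tensor,
that is, the trace of the endomorphism which represents the Ricci tensor. -/
def coordScal (G : E → E →L[ℝ] E →L[ℝ] ℝ) (y : E) : ℝ :=
  traceL E (ContinuousLinearMap.inverse (G y) ∘L coordRicci G y)

end Coordinates

/-! ## Riemannian manifolds -/

section Manifold

variable {E : Type*} [NormedAddCommGroup E] [NormedSpace ℝ E]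
  {H : Type*} [TopologicalSpace H] (I : ModelWithCorners ℝ E H)
  (M : Type*) [TopologicalSpace M] [ChartedSpace H M] [IsManifold I ∞ M]

/-- Smooth Riemannian metrics on the manifold `M`. -/
abbrev Metric : Type _ :=
  Bundle.ContMDiffRiemannianMetric I ∞ E (fun x : M ↦ TangentSpace I x)

variable {I M}

/-- The metric `g` in the preferred chart `φ` at `x`: the pull-back of `g` by `φ⁻¹`. -/
def inChart (g : Metric I M) (x : M) (y : E) : E →L[ℝ] E →L[ℝ] ℝ :=
  let q : M := (extChartAt I x).symm y
  let A : E →L[ℝ] E := mfderiv 𝓘(ℝ, E) I (extChartAt I x).symm y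
  let B : E →L[ℝ] E →L[ℝ] ℝ := g.inner q
  B.bilinearComp A A

theorem inChart_apply (g : Metric I M) (x : M) (y u v : E) :
    inChart g x y u v = g.inner ((extChartAt I x).symm y)
      (mfderiv 𝓘(ℝ, E) I (extChartAt I x).symm y u)
      (mfderiv 𝓘(ℝ, E) I (extChartAt I x).symm y v) := rfl

variable [FiniteDimensional ℝ E]

/-- The Ricci tensor of `g` at `x`, for a manifold without boundary. The tangent space at `x` is
identified with `E` through the preferred chart at `x`, which is Mathlib's definition of
`TangentSpace I x`. -/
def ricci (g : Metric I M) (x : M) (v w : TangentSpace I x) : ℝ :=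
  coordRicci (inChart g x) (extChartAt I x x) v w

/-- The scalar curvature of `g` at `x`, for a manifold without boundary. -/
def scal (g : Metric I M) (x : M) : ℝ :=
  coordScal (inChart g x) (extChartAt I x x)

/-- `Ric > 0`. -/
def PositiveRicci (g : Metric I M) : Prop :=
  ∀ (x : M) (v : TangentSpace I x), v ≠ 0 → 0 < ricci g x v v

end Manifold

/-! ## Cylinders -/

/-- The open interval `(-δ, δ)`, as an open submanifold of `ℝ`. -/
def interval (δ : ℝ) : TopologicalSpace.Opens ℝ := ⟨Set.Ioo (-δ) δ, isOpen_Ioo⟩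

/-- The point `0` of `(-δ, δ)`. -/
def origin {δ : ℝ} (hδ : 0 < δ) : interval δ := ⟨0, neg_lt_zero.mpr hδ, hδ⟩

section Cylinder

variable {E : Type*} [NormedAddCommGroup E] [NormedSpace ℝ E]
  {N : Type*} [TopologicalSpace N] [ChartedSpace E N] [IsManifold 𝓘(ℝ, E) ∞ N]

/-- Smooth Riemannian metrics on `(-δ, δ) × N`. -/
abbrev CylinderMetric (E : Type*) [NormedAddCommGroup E] [NormedSpace ℝ E] (δ : ℝ)
    (N : Type*) [TopologicalSpace N] [ChartedSpace E N] [IsManifold 𝓘(ℝ, E) ∞ N] : Type _ :=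
  Metric (𝓘(ℝ, ℝ).prod 𝓘(ℝ, E)) (interval δ × N)

/-- The tangent vector of `(-δ, δ) × N` at `p` with components `a ∂_t` and `u`. -/
def tangentPair {δ : ℝ} (p : interval δ × N) (a : ℝ) (u : TangentSpace 𝓘(ℝ, E) p.2) :
    TangentSpace (𝓘(ℝ, ℝ).prod 𝓘(ℝ, E)) p :=
  ((a, u) : ℝ × E)

/-- The tangent vector `∂_t` of `(-δ, δ) × N` at `p`. -/
def partialT {δ : ℝ} (p : interval δ × N) : TangentSpace (𝓘(ℝ, ℝ).prod 𝓘(ℝ, E)) p :=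
  tangentPair p 1 0

/-- `g = dt² + g_t`. Since `g` is smooth, the family `g_t` depends smoothly on `t`. -/
def IsCylindrical {δ : ℝ} (g : CylinderMetric E δ N) (gt : interval δ → Metric 𝓘(ℝ, E) N) : Prop :=
  ∀ (p : interval δ × N) (a b : ℝ) (u v : TangentSpace 𝓘(ℝ, E) p.2),
    g.inner p (tangentPair p a u) (tangentPair p b v) = a * b + (gt p.1).inner p.2 u v

/-- The second fundamental form `II(u, v) = g(∇_u v, ∂_t)` at `p = (t, x)` of the slice
`{t} × N` with respect to `∂_t`. In the preferred chart at `p`, which is the product of the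
coordinate `t` and the preferred chart of `N` at `x`, the slice is given by `t = const`. Hence the
constant extension in this chart of a vector tangent to the slice is tangent to the slice, and its
covariant derivative is given by the Christoffel symbols. This is the second fundamental form for
metrics such that `∂_t` is a unit normal of the slice, as it is for metrics `dt² + g_t`. -/
def sliceII {δ : ℝ} (g : CylinderMetric E δ N) (p : interval δ × N)
    (u v : TangentSpace 𝓘(ℝ, E) p.2) : ℝ :=
  g.inner p
    (christoffel (inChart g p) (extChartAt (𝓘(ℝ, ℝ).prod 𝓘(ℝ, E)) p p)
      (tangentPair p 0 u) (tangentPair p 0 v))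
    (partialT p)

/-- The slice `{t} × N` is totally geodesic: its second fundamental form vanishes. -/
def SliceTotallyGeodesic {δ : ℝ} (g : CylinderMetric E δ N) (t : interval δ) : Prop :=
  ∀ (x : N) (u v : TangentSpace 𝓘(ℝ, E) x), sliceII g (t, x) u v = 0

end Cylinder

end CylinderRicci

end

noncomputable section

namespace CylinderRicci

open Filter Topology ContinuousLinearMap

section CoordinateCalculus

theorem two_le_infty : (2 : WithTop ℕ∞) ≤ ∞ :=
  WithTop.coe_le_coe.2 (le_top : (2 : ℕ∞) ≤ ⊤)

variable {E : Type*} [NormedAddCommGroup E] [NormedSpace ℝ E]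

/-- `G` is a smooth nondegenerate metric near `y`. -/
structure IsMetricAt (G : E → E →L[ℝ] E →L[ℝ] ℝ) (y : E) : Prop where
  contDiffAt : ContDiffAt ℝ ∞ G y
  symm : ∀ᶠ z in 𝓝 y, ∀ u v, G z u v = G z v u
  isInvertible : (G y).IsInvertible

/-- The pull-back of a field of bilinear forms by a map. -/
def pullback {E' : Type*} [NormedAddCommGroup E'] [NormedSpace ℝ E'] (φ : E → E')
    (G : E' → E' →L[ℝ] E' →L[ℝ] ℝ) (y : E) : E →L[ℝ] E →L[ℝ] ℝ :=
  (G (φ y)).bilinearComp (fderiv ℝ φ y) (fderiv ℝ φ y)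

theorem pullback_apply {E' : Type*} [NormedAddCommGroup E'] [NormedSpace ℝ E'] (φ : E → E')
    (G : E' → E' →L[ℝ] E' →L[ℝ] ℝ) (y u v : E) :
    pullback φ G y u v = G (φ y) (fderiv ℝ φ y u) (fderiv ℝ φ y v) := rfl

theorem contDiffAt_flip {X F₁ F₂ F₃ : Type*} [NormedAddCommGroup X] [NormedSpace ℝ X]
    [NormedAddCommGroup F₁] [NormedSpace ℝ F₁] [NormedAddCommGroup F₂] [NormedSpace ℝ F₂]
    [NormedAddCommGroup F₃] [NormedSpace ℝ F₃] {n : WithTop ℕ∞}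
    {f : X → F₁ →L[ℝ] F₂ →L[ℝ] F₃} {x : X} (hf : ContDiffAt ℝ n f x) :
    ContDiffAt ℝ n (fun y ↦ (f y).flip) x :=
  (ContinuousLinearMap.flipₗᵢ ℝ F₁ F₂ F₃).contDiff.contDiffAt.comp x hf

theorem contDiffAt_koszul {G : E → E →L[ℝ] E →L[ℝ] ℝ} {y : E} {m n : WithTop ℕ∞}
    (hG : ContDiffAt ℝ n G y) (h : m + 1 ≤ n) : ContDiffAt ℝ m (koszul G) y := by
  have hD := hG.fderiv_right h
  have hf := contDiffAt_flip hD
  exact ((hD.add hf).sub (contDiffAt_const.clm_comp hf)).const_smul _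

theorem isInvertible_eventually [CompleteSpace E] {F : Type*} [NormedAddCommGroup F]
    [NormedSpace ℝ F] {X : Type*} [TopologicalSpace X] {G : X → E →L[ℝ] F} {y : X}
    (hG : ContinuousAt G y) (hi : (G y).IsInvertible) : ∀ᶠ z in 𝓝 y, (G z).IsInvertible := by
  obtain ⟨e, he⟩ := hi
  have : Set.range ((↑) : (E ≃L[ℝ] F) → E →L[ℝ] F) ∈ 𝓝 (G y) :=
    ContinuousLinearEquiv.isOpen.mem_nhds ⟨e, he⟩
  exact hG this

theorem apply_christoffel {G : E → E →L[ℝ] E →L[ℝ] ℝ} {y : E} (hi : (G y).IsInvertible)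
    (u v w : E) : G y (christoffel G y u v) w = koszul G y u v w := by
  rw [christoffel_apply, hi.self_apply_inverse]

section Complete

variable [CompleteSpace E]

theorem contDiffAt_christoffel {G : E → E →L[ℝ] E →L[ℝ] ℝ} {y : E} {m n : WithTop ℕ∞}
    (hG : ContDiffAt ℝ n G y) (hi : (G y).IsInvertible) (h : m + 1 ≤ n) :
    ContDiffAt ℝ m (christoffel G) y := by
  have hinv : ContDiffAt ℝ m (fun z ↦ ContinuousLinearMap.inverse (G z)) y :=
    hi.contDiffAt_map_inverse.comp y (hG.of_le (le_self_add.trans h))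
  have := ((ContinuousLinearMap.compL ℝ E (E →L[ℝ] ℝ) E).contDiff.contDiffAt (n := m)).comp y hinv
  exact this.clm_comp (contDiffAt_koszul hG h)

theorem contDiffAt_curvature {G : E → E →L[ℝ] E →L[ℝ] ℝ} {y : E} {m n : WithTop ℕ∞}
    (hG : ContDiffAt ℝ n G y) (hi : (G y).IsInvertible) (h : m + 1 + 1 ≤ n) :
    ContDiffAt ℝ m (curvature G) y := by
  have hΓ := contDiffAt_christoffel hG hi h
  have hΓm := hΓ.of_le (le_self_add : m ≤ m + 1)
  have hD := hΓ.fderiv_right le_rfl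
  have hQ : ContDiffAt ℝ m (fun z ↦ (ContinuousLinearMap.compL ℝ E E E).bilinearComp
      (christoffel G z) (christoffel G z)) y := by
    have h1 : ContDiffAt ℝ m
        (fun z ↦ (ContinuousLinearMap.compL ℝ E E E) ∘L (christoffel G z)) y :=
      contDiffAt_const.clm_comp hΓm
    exact contDiffAt_flip ((contDiffAt_flip h1).clm_comp hΓm)
  exact ((hD.sub (contDiffAt_flip hD)).add hQ).sub (contDiffAt_flip hQ)

end Complete

theorem koszul_congr {F G : E → E →L[ℝ] E →L[ℝ] ℝ} {y : E} (h : F =ᶠ[𝓝 y] G) :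
    koszul F y = koszul G y := by
  simp only [koszul, h.fderiv_eq]

theorem christoffel_congr {F G : E → E →L[ℝ] E →L[ℝ] ℝ} {y : E} (h : F =ᶠ[𝓝 y] G) :
    christoffel F y = christoffel G y := by
  simp only [christoffel, koszul_congr h, h.eq_of_nhds]

section FiniteDim

variable [FiniteDimensional ℝ E]

theorem contDiffAt_coordRicci {G : E → E →L[ℝ] E →L[ℝ] ℝ} {y : E} {m n : WithTop ℕ∞}
    (hG : ContDiffAt ℝ n G y) (hi : (G y).IsInvertible) (h : m + 1 + 1 ≤ n) :
    ContDiffAt ℝ m (coordRicci G) y := by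
  have : CompleteSpace E := FiniteDimensional.complete ℝ E
  exact contDiffAt_const.clm_comp
    (contDiffAt_const.clm_comp (contDiffAt_flip (contDiffAt_curvature hG hi h)))

theorem contDiffAt_coordScal {G : E → E →L[ℝ] E →L[ℝ] ℝ} {y : E} {m n : WithTop ℕ∞}
    (hG : ContDiffAt ℝ n G y) (hi : (G y).IsInvertible) (h : m + 1 + 1 ≤ n) :
    ContDiffAt ℝ m (coordScal G) y := by
  have : CompleteSpace E := FiniteDimensional.complete ℝ E
  have hinv : ContDiffAt ℝ m (fun z ↦ ContinuousLinearMap.inverse (G z)) y :=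
    hi.contDiffAt_map_inverse.comp y (hG.of_le (le_self_add.trans (le_self_add.trans h)))
  exact contDiffAt_const.clm_apply (hinv.clm_comp (contDiffAt_coordRicci hG hi h))

theorem coordRicci_congr {F G : E → E →L[ℝ] E →L[ℝ] ℝ} {y : E} (h : F =ᶠ[𝓝 y] G) :
    coordRicci F y = coordRicci G y := by
  have h1 : christoffel F =ᶠ[𝓝 y] christoffel G :=
    h.eventuallyEq_nhds.mono fun z hz ↦ christoffel_congr hz
  simp only [coordRicci, curvature, h1.fderiv_eq, h1.eq_of_nhds]

end FiniteDim

section Tensoriality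

variable {E' : Type*} [NormedAddCommGroup E'] [NormedSpace ℝ E']
  {φ : E → E'} {F : E → E →L[ℝ] E →L[ℝ] ℝ} {G : E' → E' →L[ℝ] E' →L[ℝ] ℝ} {y : E}

theorem contDiffAt_pullback {n : WithTop ℕ∞} (hG : ContDiffAt ℝ n G (φ y))
    (hφ : ContDiffAt ℝ (n + 1) φ y) : ContDiffAt ℝ n (pullback φ G) y := by
  have hD := hφ.fderiv_right le_rfl
  have hGφ : ContDiffAt ℝ n (fun z ↦ G (φ z)) y := hG.comp y (hφ.of_le le_self_add)
  exact contDiffAt_flip ((contDiffAt_flip (hGφ.clm_comp hD)).clm_comp hD)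

theorem fderiv_pullback (hG : ContDiffAt ℝ 1 G (φ y)) (hφ : ContDiffAt ℝ 2 φ y) (x u v : E) :
    fderiv ℝ (pullback φ G) y x u v =
      fderiv ℝ G (φ y) (fderiv ℝ φ y x) (fderiv ℝ φ y u) (fderiv ℝ φ y v)
      + G (φ y) (fderiv ℝ (fderiv ℝ φ) y x u) (fderiv ℝ φ y v)
      + G (φ y) (fderiv ℝ φ y u) (fderiv ℝ (fderiv ℝ φ) y x v) := by
  have h1 : HasFDerivAt φ (fderiv ℝ φ y) y :=
    (hφ.differentiableAt (by norm_num)).hasFDerivAt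
  have h2 : HasFDerivAt (fderiv ℝ φ) (fderiv ℝ (fderiv ℝ φ) y) y :=
    ((hφ.fderiv_right (m := 1) (by norm_num)).differentiableAt (by norm_num)).hasFDerivAt
  have h3 : HasFDerivAt (fun z ↦ G (φ z)) _ y :=
    (hG.differentiableAt (by norm_num)).hasFDerivAt.comp y h1
  have hu : ∀ w : E, HasFDerivAt (fun z ↦ fderiv ℝ φ z w) _ y := fun w ↦
    h2.clm_apply (hasFDerivAt_const w y)
  have key := ((h3.clm_apply (hu u)).clm_apply (hu v))
  have hd : DifferentiableAt ℝ (pullback φ G) y :=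
    (contDiffAt_pullback hG (by simpa [one_add_one_eq_two] using hφ)).differentiableAt
      (by norm_num)
  have h4 : HasFDerivAt (fun z ↦ pullback φ G z u v) _ y :=
    (hd.hasFDerivAt.clm_apply (hasFDerivAt_const u y)).clm_apply (hasFDerivAt_const v y)
  have := congrArg (fun L ↦ L x) (h4.unique key)
  simpa [add_comm, add_left_comm, add_assoc] using this

theorem koszul_pullback (hG : ContDiffAt ℝ 1 G (φ y))
    (hs : ∀ᶠ z in 𝓝 (φ y), ∀ u v, G z u v = G z v u) (hφ : ContDiffAt ℝ 2 φ y) (u v w : E) :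
    koszul (pullback φ G) y u v w =
      koszul G (φ y) (fderiv ℝ φ y u) (fderiv ℝ φ y v) (fderiv ℝ φ y w)
      + G (φ y) (fderiv ℝ (fderiv ℝ φ) y u v) (fderiv ℝ φ y w) := by
  have hsym := hφ.isSymmSndFDerivAt (by simp)
  simp only [koszul_apply, fderiv_pullback hG hφ]
  rw [hsym.eq w u, hsym.eq w v, hsym.eq v u,
    hs.self_of_nhds _ (fderiv ℝ (fderiv ℝ φ) y u w), hs.self_of_nhds _ (fderiv ℝ (fderiv ℝ φ) y v w)]
  ring

end Tensoriality

theorem ext_of_isInvertible {B : E →L[ℝ] E →L[ℝ] ℝ} (hB : B.IsInvertible) {u v : E}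
    (h : ∀ w, B u w = B v w) : u = v :=
  hB.injective (by ext w; exact h w)

section TensorialityFiniteDim

variable [FiniteDimensional ℝ E]

theorem isInvertible_of_nondegenerate (B : E →L[ℝ] E →L[ℝ] ℝ)
    (hB : ∀ u, (∀ v, B u v = 0) → u = 0) : B.IsInvertible := by
  have hinj : Function.Injective B :=
    (injective_iff_map_eq_zero B).2 fun u hu ↦ hB u fun v ↦ by simp [hu]
  have hr : Module.finrank ℝ E = Module.finrank ℝ (E →L[ℝ] ℝ) := by
    rw [← (LinearMap.toContinuousLinearMap : (E →ₗ[ℝ] ℝ) ≃ₗ[ℝ] _).finrank_eq]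
    exact (Subspace.dual_finrank_eq (K := ℝ) (V := E)).symm
  refine ⟨(LinearEquiv.ofInjectiveOfFinrankEq (B : E →ₗ[ℝ] E →L[ℝ] ℝ) hinj hr
    ).toContinuousLinearEquiv, ?_⟩
  ext u v
  rfl

variable {E' : Type*} [NormedAddCommGroup E'] [NormedSpace ℝ E'] [FiniteDimensional ℝ E']
  {φ : E → E'} {F : E → E →L[ℝ] E →L[ℝ] ℝ} {G : E' → E' →L[ℝ] E' →L[ℝ] ℝ} {y : E}

omit [FiniteDimensional ℝ E'] in
theorem isInvertible_pullback (hG : (G (φ y)).IsInvertible) (hφ : (fderiv ℝ φ y).IsInvertible) :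
    (pullback φ G y).IsInvertible := by
  refine isInvertible_of_nondegenerate _ fun u hu ↦ hφ.injective ?_
  refine ext_of_isInvertible hG fun w ↦ ?_
  obtain ⟨w, rfl⟩ := hφ.surjective w
  simpa [pullback_apply] using hu w

omit [FiniteDimensional ℝ E'] in
theorem christoffel_pullback (hG : ContDiffAt ℝ 1 G (φ y))
    (hs : ∀ᶠ z in 𝓝 (φ y), ∀ u v, G z u v = G z v u) (hi : (G (φ y)).IsInvertible)
    (hφ : ContDiffAt ℝ 2 φ y) (hφi : (fderiv ℝ φ y).IsInvertible) (u v : E) :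
    fderiv ℝ φ y (christoffel (pullback φ G) y u v) =
      christoffel G (φ y) (fderiv ℝ φ y u) (fderiv ℝ φ y v) + fderiv ℝ (fderiv ℝ φ) y u v := by
  refine ext_of_isInvertible hi fun w ↦ ?_
  obtain ⟨w, rfl⟩ := hφi.surjective w
  rw [← pullback_apply, apply_christoffel (isInvertible_pullback hi hφi),
    koszul_pullback hG hs hφ, map_add, add_apply, apply_christoffel hi]

theorem fderiv_christoffel_pullback (hG : IsMetricAt G (φ y)) (hφ : ContDiffAt ℝ ∞ φ y)
    (hφi : (fderiv ℝ φ y).IsInvertible) (x u v : E) :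
    fderiv ℝ φ y (fderiv ℝ (christoffel (pullback φ G)) y x u v)
      + fderiv ℝ (fderiv ℝ φ) y x (christoffel (pullback φ G) y u v) =
    fderiv ℝ (christoffel G) (φ y) (fderiv ℝ φ y x) (fderiv ℝ φ y u) (fderiv ℝ φ y v)
      + christoffel G (φ y) (fderiv ℝ (fderiv ℝ φ) y x u) (fderiv ℝ φ y v)
      + christoffel G (φ y) (fderiv ℝ φ y u) (fderiv ℝ (fderiv ℝ φ) y x v)
      + fderiv ℝ (fderiv ℝ (fderiv ℝ φ)) y x u v := by
  have : CompleteSpace E := FiniteDimensional.complete ℝ E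
  have : CompleteSpace E' := FiniteDimensional.complete ℝ E'
  have c2 : ContDiffAt ℝ ∞ (fderiv ℝ φ) y := hφ.fderiv_right (by simp)
  have c3 : ContDiffAt ℝ ∞ (fderiv ℝ (fderiv ℝ φ)) y := c2.fderiv_right (by simp)
  have hne : (∞ : WithTop ℕ∞) ≠ 0 := by simp
  have d1 := (hφ.differentiableAt hne).hasFDerivAt
  have d2 := (c2.differentiableAt hne).hasFDerivAt
  have d3 := (c3.differentiableAt hne).hasFDerivAt
  have dG := ((contDiffAt_christoffel hG.contDiffAt hG.isInvertible
    (m := ∞) (by simp)).differentiableAt hne).hasFDerivAt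
  have dF := ((contDiffAt_christoffel (contDiffAt_pullback hG.contDiffAt (by simpa using hφ))
    (isInvertible_pullback hG.isInvertible hφi) (m := ∞) (by simp)).differentiableAt hne).hasFDerivAt
  have dΓ : HasFDerivAt (fun z ↦ christoffel G (φ z)) _ y := dG.comp y d1
  have hw : ∀ w : E, HasFDerivAt (fun z ↦ fderiv ℝ φ z w) _ y := fun w ↦
    d2.clm_apply (hasFDerivAt_const w y)
  have L := d2.clm_apply
    ((dF.clm_apply (hasFDerivAt_const u y)).clm_apply (hasFDerivAt_const v y))
  have R := ((dΓ.clm_apply (hw u)).clm_apply (hw v)).add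
    ((d3.clm_apply (hasFDerivAt_const u y)).clm_apply (hasFDerivAt_const v y))
  have e1 : ∀ᶠ z in 𝓝 y, ContDiffAt ℝ 1 G (φ z) :=
    hφ.continuousAt.eventually ((hG.contDiffAt.of_le (m := 1) (by simp)).eventually (by simp))
  have e2 : ∀ᶠ z in 𝓝 y, ∀ᶠ q in 𝓝 (φ z), ∀ u v, G q u v = G q v u :=
    hφ.continuousAt.eventually hG.symm.eventually_nhds
  have e3 : ∀ᶠ z in 𝓝 y, (G (φ z)).IsInvertible :=
    hφ.continuousAt.eventually
      (isInvertible_eventually hG.contDiffAt.continuousAt hG.isInvertible)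
  have e4 : ∀ᶠ z in 𝓝 y, ContDiffAt ℝ 2 φ z :=
    (hφ.of_le (m := 2) two_le_infty).eventually (by simp)
  have e5 : ∀ᶠ z in 𝓝 y, (fderiv ℝ φ z).IsInvertible :=
    isInvertible_eventually c2.continuousAt hφi
  have he : (fun z ↦ fderiv ℝ φ z (christoffel (pullback φ G) z u v)) =ᶠ[𝓝 y]
      fun z ↦ christoffel G (φ z) (fderiv ℝ φ z u) (fderiv ℝ φ z v)
        + fderiv ℝ (fderiv ℝ φ) z u v := by
    filter_upwards [e1, e2, e3, e4, e5] with z h1 h2 h3 h4 h5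
    exact christoffel_pullback h1 h2 h3 h4 h5 u v
  have := congrArg (fun L ↦ L x) (L.unique (R.congr_of_eventuallyEq he))
  simpa [add_comm, add_left_comm, add_assoc] using this

theorem curvature_pullback (hG : IsMetricAt G (φ y)) (hφ : ContDiffAt ℝ ∞ φ y)
    (hφi : (fderiv ℝ φ y).IsInvertible) (x u v : E) :
    fderiv ℝ φ y (curvature (pullback φ G) y x u v) =
      curvature G (φ y) (fderiv ℝ φ y x) (fderiv ℝ φ y u) (fderiv ℝ φ y v) := by
  have hΓ := christoffel_pullback (hG.contDiffAt.of_le (m := 1) (by simp)) hG.symm hG.isInvertible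
    (hφ.of_le (m := 2) two_le_infty) hφi
  have h1 := eq_sub_of_add_eq (fderiv_christoffel_pullback hG hφ hφi x u v)
  have h2 := eq_sub_of_add_eq (fderiv_christoffel_pullback hG hφ hφi u x v)
  have c2 : ContDiffAt ℝ ∞ (fderiv ℝ φ) y := hφ.fderiv_right (by simp)
  have hsym := (hφ.isSymmSndFDerivAt (by simpa using two_le_infty)).eq x u
  have hsym3 := congrArg (fun L ↦ L v) ((c2.isSymmSndFDerivAt (by simpa using two_le_infty)).eq x u)
  simp only [curvature_apply, map_add, map_sub, h1, h2, hΓ, hsym, hsym3]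
  abel

theorem traceL_eq_of_intertwines {A : E →L[ℝ] E'} (hA : A.IsInvertible) {S : E →L[ℝ] E}
    {T : E' →L[ℝ] E'} (h : ∀ u, A (S u) = T (A u)) : traceL E S = traceL E' T := by
  obtain ⟨e, rfl⟩ := hA
  rw [traceL_apply, traceL_apply, ← LinearMap.trace_conj' (S : E →ₗ[ℝ] E) e.toLinearEquiv]
  congr 1
  ext u
  simpa [LinearEquiv.conj_apply] using h (e.symm u)

theorem coordRicci_pullback (hF : F =ᶠ[𝓝 y] pullback φ G) (hG : IsMetricAt G (φ y))
    (hφ : ContDiffAt ℝ ∞ φ y) (hφi : (fderiv ℝ φ y).IsInvertible) (v w : E) :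
    coordRicci F y v w = coordRicci G (φ y) (fderiv ℝ φ y v) (fderiv ℝ φ y w) := by
  rw [coordRicci_congr hF, coordRicci_apply, coordRicci_apply]
  exact traceL_eq_of_intertwines hφi fun u ↦ curvature_pullback hG hφ hφi u v w

theorem coordScal_pullback (hF : F =ᶠ[𝓝 y] pullback φ G) (hG : IsMetricAt G (φ y))
    (hφ : ContDiffAt ℝ ∞ φ y) (hφi : (fderiv ℝ φ y).IsInvertible) :
    coordScal F y = coordScal G (φ y) := by
  refine traceL_eq_of_intertwines hφi fun u ↦ ext_of_isInvertible hG.isInvertible fun w ↦ ?_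
  obtain ⟨w, rfl⟩ := hφi.surjective w
  have hFi : (F y).IsInvertible := by
    rw [hF.eq_of_nhds]; exact isInvertible_pullback hG.isInvertible hφi
  rw [← pullback_apply, ← hF.eq_of_nhds]
  simp only [coe_comp, Function.comp_apply, hFi.self_apply_inverse,
    hG.isInvertible.self_apply_inverse]
  exact coordRicci_pullback hF hG hφ hφi u w

end TensorialityFiniteDim
end CoordinateCalculus

section Trace

variable {E : Type*} [NormedAddCommGroup E] [NormedSpace ℝ E] [FiniteDimensional ℝ E]

theorem isInvertible_of_pos {B : E →L[ℝ] E →L[ℝ] ℝ} (hpos : ∀ v, v ≠ 0 → 0 < B v v) :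
    B.IsInvertible :=
  isInvertible_of_nondegenerate B fun u hu ↦ by
    by_contra h
    exact (hpos u h).ne' (hu u)

/-- The trace of a bilinear form with respect to a scalar product, in an orthogonal basis. -/
theorem exists_basis_traceL_inverse_comp {B : E →L[ℝ] E →L[ℝ] ℝ} (hs : ∀ u v, B u v = B v u)
    (hpos : ∀ v, v ≠ 0 → 0 < B v v) :
    ∃ b : Module.Basis (Fin (Module.finrank ℝ E)) ℝ E, ∀ P : E →L[ℝ] E →L[ℝ] ℝ,
      traceL E (ContinuousLinearMap.inverse B ∘L P) = ∑ i, P (b i) (b i) / B (b i) (b i) := by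
  let B' : LinearMap.BilinForm ℝ E :=
    (ContinuousLinearMap.coeLM ℝ : (E →L[ℝ] ℝ) →ₗ[ℝ] E →ₗ[ℝ] ℝ) ∘ₗ (B : E →ₗ[ℝ] E →L[ℝ] ℝ)
  have hB' : ∀ u v, B' u v = B u v := fun _ _ ↦ rfl
  have hsym : LinearMap.IsSymm B' := ⟨fun u v ↦ hs u v⟩
  obtain ⟨b, hb⟩ := LinearMap.BilinForm.exists_orthogonal_basis hsym
  have horth : ∀ i j, i ≠ j → B (b i) (b j) = 0 := fun i j hij ↦ hb hij
  have hrepr : ∀ x i, b.repr x i = B x (b i) / B (b i) (b i) := by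
    intro x i
    have h0 := (hpos (b i) (b.ne_zero i)).ne'
    rw [eq_div_iff h0]
    conv_rhs => rw [← b.sum_repr x]
    simp only [map_sum, map_smul, sum_apply, smul_apply,
      smul_eq_mul]
    rw [Finset.sum_eq_single i (fun j _ hj ↦ by rw [horth j i hj, mul_zero]) (by simp)]
  refine ⟨b, fun P ↦ ?_⟩
  rw [traceL_apply, LinearMap.trace_eq_matrix_trace ℝ b]
  simp only [Matrix.trace, Matrix.diag, LinearMap.toMatrix_apply]
  refine Finset.sum_congr rfl fun i _ ↦ ?_
  rw [hrepr]
  simp [(isInvertible_of_pos hpos).self_apply_inverse]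

theorem traceL_inverse_comp_flip {B : E →L[ℝ] E →L[ℝ] ℝ} (hs : ∀ u v, B u v = B v u)
    (hpos : ∀ v, v ≠ 0 → 0 < B v v) (P : E →L[ℝ] E →L[ℝ] ℝ) :
    traceL E (ContinuousLinearMap.inverse B ∘L P.flip) =
      traceL E (ContinuousLinearMap.inverse B ∘L P) := by
  obtain ⟨b, hb⟩ := exists_basis_traceL_inverse_comp hs hpos
  simp [hb]

theorem traceL_inverse_comp_nonneg {B : E →L[ℝ] E →L[ℝ] ℝ} (hs : ∀ u v, B u v = B v u)
    (hpos : ∀ v, v ≠ 0 → 0 < B v v) {P : E →L[ℝ] E →L[ℝ] ℝ} (hP : ∀ v, v ≠ 0 → 0 < P v v) :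
    0 ≤ traceL E (ContinuousLinearMap.inverse B ∘L P) := by
  obtain ⟨b, hb⟩ := exists_basis_traceL_inverse_comp hs hpos
  rw [hb]
  exact Finset.sum_nonneg fun i _ ↦
    div_nonneg (hP _ (b.ne_zero i)).le (hpos _ (b.ne_zero i)).le

theorem traceL_inverse_comp_self {B : E →L[ℝ] E →L[ℝ] ℝ} (hB : B.IsInvertible) :
    traceL E (ContinuousLinearMap.inverse B ∘L B) = Module.finrank ℝ E := by
  rw [hB.inverse_comp_self, traceL_apply, ContinuousLinearMap.coe_id, LinearMap.trace_id]

theorem traceL_prod (L : ℝ × E →L[ℝ] ℝ × E) :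
    traceL (ℝ × E) L = (L (1, 0)).1 +
      traceL E ((ContinuousLinearMap.snd ℝ ℝ E) ∘L L ∘L (ContinuousLinearMap.inr ℝ ℝ E)) := by
  have h : (L : ℝ × E →ₗ[ℝ] ℝ × E) =
      LinearMap.inl ℝ ℝ E ∘ₗ (LinearMap.fst ℝ ℝ E ∘ₗ L)
        + LinearMap.inr ℝ ℝ E ∘ₗ (LinearMap.snd ℝ ℝ E ∘ₗ L) := by
    refine LinearMap.ext fun X ↦ ?_
    simp
  rw [traceL_apply, h, map_add, LinearMap.trace_comp_comm',
    LinearMap.trace_comp_comm' (LinearMap.snd ℝ ℝ E ∘ₗ (L : ℝ × E →ₗ[ℝ] ℝ × E))]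
  congr 1
  rw [LinearMap.trace_eq_matrix_trace ℝ (Module.Basis.singleton Unit ℝ)]
  simp [Matrix.trace, LinearMap.toMatrix_apply]

end Trace

section CylinderCoordinates

variable {E : Type*} [NormedAddCommGroup E] [NormedSpace ℝ E]

/-- The metric `dt² + K` in coordinates. -/
def cyl (K : ℝ × E → E →L[ℝ] E →L[ℝ] ℝ) (z : ℝ × E) : ℝ × E →L[ℝ] ℝ × E →L[ℝ] ℝ :=
  (ContinuousLinearMap.mul ℝ ℝ).bilinearComp (.fst ℝ ℝ E) (.fst ℝ ℝ E)
    + (K z).bilinearComp (.snd ℝ ℝ E) (.snd ℝ ℝ E)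

@[simp] theorem cyl_apply (K : ℝ × E → E →L[ℝ] E →L[ℝ] ℝ) (z X Y : ℝ × E) :
    cyl K z X Y = X.1 * Y.1 + K z X.2 Y.2 := rfl

variable {K : ℝ × E → E →L[ℝ] E →L[ℝ] ℝ} {z : ℝ × E}

theorem contDiffAt_cyl {n : WithTop ℕ∞} (hK : ContDiffAt ℝ n K z) :
    ContDiffAt ℝ n (cyl K) z := by
  exact contDiffAt_const.add (contDiffAt_flip
    ((contDiffAt_flip (hK.clm_comp contDiffAt_const)).clm_comp contDiffAt_const))

theorem fderiv_cyl (hK : ContDiffAt ℝ 1 K z) (X Y Z : ℝ × E) :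
    fderiv ℝ (cyl K) z X Y Z = fderiv ℝ K z X Y.2 Z.2 := by
  have h1 : HasFDerivAt (fun q ↦ cyl K q Y Z) _ z :=
    ((((contDiffAt_cyl hK).differentiableAt (by norm_num)).hasFDerivAt.clm_apply
      (hasFDerivAt_const Y z)).clm_apply (hasFDerivAt_const Z z))
  have h2 : HasFDerivAt (fun q ↦ cyl K q Y Z) _ z :=
    ((((hK.differentiableAt (by norm_num)).hasFDerivAt.clm_apply
      (hasFDerivAt_const Y.2 z)).clm_apply (hasFDerivAt_const Z.2 z)).const_add (Y.1 * Z.1))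
  have := congrArg (fun L ↦ L X) (h1.unique h2)
  simpa using this

theorem koszul_cyl (hK : ContDiffAt ℝ 1 K z) (X Y Z : ℝ × E) :
    koszul (cyl K) z X Y Z = (1 / 2 : ℝ) * (fderiv ℝ K z X Y.2 Z.2 + fderiv ℝ K z Y X.2 Z.2
      - fderiv ℝ K z Z X.2 Y.2) := by
  simp only [koszul_apply, fderiv_cyl hK]

theorem isInvertible_cyl [FiniteDimensional ℝ E] (hi : (K z).IsInvertible) :
    (cyl K z).IsInvertible := by
  refine isInvertible_of_nondegenerate _ fun X hX ↦ ?_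
  have h1 : X.1 = 0 := by simpa using hX (1, 0)
  have h2 : X.2 = 0 := ext_of_isInvertible hi fun w ↦ by simpa using hX (0, w)
  exact Prod.ext h1 h2

theorem christoffel_cyl_fst [FiniteDimensional ℝ E] (hK : ContDiffAt ℝ 1 K z)
    (hi : (K z).IsInvertible) (X Y : ℝ × E) :
    (christoffel (cyl K) z X Y).1 = -(1 / 2 : ℝ) * fderiv ℝ K z (1, 0) X.2 Y.2 := by
  have := apply_christoffel (isInvertible_cyl hi) X Y (1, 0)
  rw [koszul_cyl hK] at this
  simpa using this

theorem apply_christoffel_cyl_snd [FiniteDimensional ℝ E] (hK : ContDiffAt ℝ 1 K z)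
    (hi : (K z).IsInvertible) (X Y : ℝ × E) (w : E) :
    K z (christoffel (cyl K) z X Y).2 w = (1 / 2 : ℝ) * (fderiv ℝ K z X Y.2 w
      + fderiv ℝ K z Y X.2 w - fderiv ℝ K z (0, w) X.2 Y.2) := by
  have := apply_christoffel (isInvertible_cyl hi) X Y (0, w)
  rw [koszul_cyl hK] at this
  simpa using this

section Curvature

variable [FiniteDimensional ℝ E] (hK : ContDiffAt ℝ ∞ K z) (hi : (K z).IsInvertible)

include hK hi

theorem hasFDerivAt_christoffel_cyl : HasFDerivAt (christoffel (cyl K))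
    (fderiv ℝ (christoffel (cyl K)) z) z :=
  have : CompleteSpace E := FiniteDimensional.complete ℝ E
  ((contDiffAt_christoffel (contDiffAt_cyl hK) (isInvertible_cyl hi)
    (m := ∞) (by simp)).differentiableAt (by simp)).hasFDerivAt

theorem eventually_regular : ∀ᶠ q in 𝓝 z, ContDiffAt ℝ 1 K q ∧ (K q).IsInvertible :=
  have : CompleteSpace E := FiniteDimensional.complete ℝ E
  ((hK.of_le (m := 1) (by simp)).eventually (by simp)).and
    (isInvertible_eventually hK.continuousAt hi)

theorem fderiv_christoffel_cyl_fst (X Y Z : ℝ × E) :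
    (fderiv ℝ (christoffel (cyl K)) z X Y Z).1 =
      -(1 / 2 : ℝ) * fderiv ℝ (fderiv ℝ K) z X (1, 0) Y.2 Z.2 := by
  have d2 := ((hK.fderiv_right (m := ∞) (by simp)).differentiableAt (by simp)).hasFDerivAt
  have L : HasFDerivAt (fun q ↦ (christoffel (cyl K) q Y Z).1) _ z :=
    (((hasFDerivAt_christoffel_cyl hK hi).clm_apply (hasFDerivAt_const Y z)).clm_apply
      (hasFDerivAt_const Z z)).fst
  have R : HasFDerivAt (fun q ↦ -(1 / 2 : ℝ) * fderiv ℝ K q (1, 0) Y.2 Z.2) _ z :=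
    (((d2.clm_apply (hasFDerivAt_const ((1 : ℝ), (0 : E)) z)).clm_apply
      (hasFDerivAt_const Y.2 z)).clm_apply (hasFDerivAt_const Z.2 z)).const_mul (-(1 / 2 : ℝ))
  have he : (fun q ↦ (christoffel (cyl K) q Y Z).1) =ᶠ[𝓝 z]
      fun q ↦ -(1 / 2 : ℝ) * fderiv ℝ K q (1, 0) Y.2 Z.2 :=
    (eventually_regular hK hi).mono fun q hq ↦ christoffel_cyl_fst hq.1 hq.2 Y Z
  have := congrArg (fun L ↦ L X) (L.unique (R.congr_of_eventuallyEq he))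
  simpa using this

theorem apply_fderiv_christoffel_cyl_snd (X Y Z : ℝ × E) (w : E) :
    K z (fderiv ℝ (christoffel (cyl K)) z X Y Z).2 w
        + fderiv ℝ K z X (christoffel (cyl K) z Y Z).2 w =
      (1 / 2 : ℝ) * (fderiv ℝ (fderiv ℝ K) z X Y Z.2 w + fderiv ℝ (fderiv ℝ K) z X Z Y.2 w
        - fderiv ℝ (fderiv ℝ K) z X (0, w) Y.2 Z.2) := by
  have d1 := (hK.differentiableAt (by simp)).hasFDerivAt
  have d2 := ((hK.fderiv_right (m := ∞) (by simp)).differentiableAt (by simp)).hasFDerivAt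
  have d2' : ∀ (A : ℝ × E) (u v : E), HasFDerivAt (fun q ↦ fderiv ℝ K q A u v) _ z := fun A u v ↦
    ((d2.clm_apply (hasFDerivAt_const A z)).clm_apply
      (hasFDerivAt_const u z)).clm_apply (hasFDerivAt_const v z)
  have L : HasFDerivAt (fun q ↦ K q (christoffel (cyl K) q Y Z).2 w) _ z :=
    (d1.clm_apply (((hasFDerivAt_christoffel_cyl hK hi).clm_apply
      (hasFDerivAt_const Y z)).clm_apply (hasFDerivAt_const Z z)).snd).clm_apply
      (hasFDerivAt_const w z)
  have R := (((d2' Y Z.2 w).add (d2' Z Y.2 w)).sub (d2' (0, w) Y.2 Z.2)).const_mul (1 / 2 : ℝ)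
  have he : (fun q ↦ K q (christoffel (cyl K) q Y Z).2 w) =ᶠ[𝓝 z]
      fun q ↦ (1 / 2 : ℝ) * (fderiv ℝ K q Y Z.2 w + fderiv ℝ K q Z Y.2 w
        - fderiv ℝ K q (0, w) Y.2 Z.2) :=
    (eventually_regular hK hi).mono fun q hq ↦ apply_christoffel_cyl_snd hq.1 hq.2 Y Z w
  have := congrArg (fun L ↦ L X) (L.unique (R.congr_of_eventuallyEq he))
  simpa using this

variable (h0 : fderiv ℝ K z (1, 0) = 0)

include h0

theorem christoffel_cyl_partialT_right (X : ℝ × E) : christoffel (cyl K) z X (1, 0) = 0 := by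
  have h1 : ContDiffAt ℝ 1 K z := hK.of_le (by simp)
  refine Prod.ext ?_ (ext_of_isInvertible hi fun w ↦ ?_)
  · simp [christoffel_cyl_fst h1 hi]
  · simp [apply_christoffel_cyl_snd h1 hi, h0]

theorem christoffel_cyl_partialT_left (X : ℝ × E) : christoffel (cyl K) z (1, 0) X = 0 := by
  have h1 : ContDiffAt ℝ 1 K z := hK.of_le (by simp)
  refine Prod.ext ?_ (ext_of_isInvertible hi fun w ↦ ?_)
  · simp [christoffel_cyl_fst h1 hi]
  · simp [apply_christoffel_cyl_snd h1 hi, h0]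

theorem coordRicci_cyl_normal : coordRicci (cyl K) z (1, 0) (1, 0) =
    -(1 / 2 : ℝ) * traceL E (ContinuousLinearMap.inverse (K z) ∘L
      fderiv ℝ (fderiv ℝ K) z (1, 0) (1, 0)) := by
  have hr := christoffel_cyl_partialT_right hK hi h0
  have hl := christoffel_cyl_partialT_left hK hi h0
  rw [coordRicci_apply, traceL_prod]
  have h1 : (curvature (cyl K) z (1, 0) (1, 0) (1, 0)).1 = 0 := by
    simp [curvature_apply]
  have h2 : (ContinuousLinearMap.snd ℝ ℝ E) ∘L
      (((curvature (cyl K) z).flip (1, 0)).flip (1, 0)) ∘L (ContinuousLinearMap.inr ℝ ℝ E) =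
      (-(1 / 2 : ℝ)) • (ContinuousLinearMap.inverse (K z) ∘L
        fderiv ℝ (fderiv ℝ K) z (1, 0) (1, 0)) := by
    ext u
    refine ext_of_isInvertible hi fun w ↦ ?_
    have e1 := apply_fderiv_christoffel_cyl_snd hK hi (0, u) (1, 0) (1, 0) w
    have e2 := apply_fderiv_christoffel_cyl_snd hK hi (1, 0) (0, u) (1, 0) w
    simp only [hr, Prod.snd_zero, map_zero, zero_apply, add_zero, zero_add, sub_zero] at e1 e2
    simp [curvature_apply, hr, hl, e1, e2, hi.self_apply_inverse]
  simp only [flip_apply] at h1 h2 ⊢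
  rw [h1, h2, map_smul, zero_add, smul_eq_mul]

theorem coordRicci_cyl_tangential (v w : E) : coordRicci (cyl K) z (0, v) (0, w) =
    coordRicci (fun y ↦ K (z.1, y)) z.2 v w
      - (1 / 2 : ℝ) * fderiv ℝ (fderiv ℝ K) z (1, 0) (1, 0) v w := by
  have hl := christoffel_cyl_partialT_left hK hi h0
  have hr := christoffel_cyl_partialT_right hK hi h0
  have : CompleteSpace E := FiniteDimensional.complete ℝ E
  have hslice : ∀ y : E, HasFDerivAt (fun y : E ↦ (z.1, y)) (ContinuousLinearMap.inr ℝ ℝ E) y :=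
    fun y ↦ hasFDerivAt_prodMk_right z.1 y
  have hcont : ContinuousAt (fun y : E ↦ (z.1, y)) z.2 := (hslice z.2).continuousAt
  have hreg := hcont.eventually (eventually_regular hK hi)
  have hK0 : ContDiffAt ℝ ∞ (fun y ↦ K (z.1, y)) z.2 :=
    ContDiffAt.comp z.2 hK (contDiffAt_const.prodMk contDiffAt_id)
  have hΓ : ∀ y, ContDiffAt ℝ 1 K (z.1, y) ∧ (K (z.1, y)).IsInvertible → ∀ v w : E,
      (christoffel (cyl K) (z.1, y) (0, v) (0, w)).2 =
        christoffel (fun y ↦ K (z.1, y)) y v w := by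
    intro y hy v w
    have hd : HasFDerivAt (fun y ↦ K (z.1, y)) _ y :=
      (hy.1.differentiableAt (by norm_num)).hasFDerivAt.comp y (hslice y)
    refine ext_of_isInvertible hy.2 fun x ↦ ?_
    rw [apply_christoffel_cyl_snd hy.1 hy.2,
      apply_christoffel (G := fun y ↦ K (z.1, y)) hy.2, koszul_apply, hd.fderiv]
    simp
  have hz : ContDiffAt ℝ 1 K (z.1, z.2) ∧ (K (z.1, z.2)).IsInvertible := hreg.self_of_nhds
  have hΓz : ∀ v w : E, christoffel (cyl K) z (0, v) (0, w) =
      (0, christoffel (fun y ↦ K (z.1, y)) z.2 v w) := fun v w ↦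
    Prod.ext (by simp [christoffel_cyl_fst hz.1 hz.2, h0]) (hΓ z.2 hz v w)
  have hDΓ : ∀ u v w : E, (fderiv ℝ (christoffel (cyl K)) z (0, u) (0, v) (0, w)).2 =
      fderiv ℝ (christoffel (fun y ↦ K (z.1, y))) z.2 u v w := by
    intro u v w
    have d : HasFDerivAt (fun y ↦ christoffel (cyl K) (z.1, y)) _ z.2 :=
      HasFDerivAt.comp (g := christoffel (cyl K)) z.2
        (hasFDerivAt_christoffel_cyl hK hi) (hslice z.2)
    have L : HasFDerivAt (fun y ↦ (christoffel (cyl K) (z.1, y) (0, v) (0, w)).2) _ z.2 :=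
      ((d.clm_apply (hasFDerivAt_const _ _)).clm_apply (hasFDerivAt_const _ _)).snd
    have d' := ((contDiffAt_christoffel hK0 hi (m := ∞) (by simp)).differentiableAt
      (by simp)).hasFDerivAt
    have R := (d'.clm_apply (hasFDerivAt_const v _)).clm_apply (hasFDerivAt_const w _)
    have := congrArg (fun L ↦ L u) (L.unique (R.congr_of_eventuallyEq
      (hreg.mono fun y hy ↦ hΓ y hy v w)))
    simpa using this
  rw [coordRicci_apply, coordRicci_apply, traceL_prod]
  have h1 : (curvature (cyl K) z (1, 0) (0, v) (0, w)).1 =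
      -(1 / 2 : ℝ) * fderiv ℝ (fderiv ℝ K) z (1, 0) (1, 0) v w := by
    simp [curvature_apply, hl, fderiv_christoffel_cyl_fst hK hi]
  have h2 : (ContinuousLinearMap.snd ℝ ℝ E) ∘L
      (((curvature (cyl K) z).flip (0, v)).flip (0, w)) ∘L (ContinuousLinearMap.inr ℝ ℝ E) =
      ((curvature (fun y ↦ K (z.1, y)) z.2).flip v).flip w := by
    ext u
    simp [curvature_apply, hΓz, hDΓ]
  simp only [flip_apply] at h1 h2 ⊢
  rw [h1, h2]
  ring

variable (hmix : ∀ u, fderiv ℝ (fderiv ℝ K) z (0, u) (1, 0) = 0)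

include hmix

theorem coordRicci_cyl_mixed_left (w : E) : coordRicci (cyl K) z (1, 0) (0, w) = 0 := by
  have hr := christoffel_cyl_partialT_right hK hi h0
  have hl := christoffel_cyl_partialT_left hK hi h0
  have hmix' : ∀ u, fderiv ℝ (fderiv ℝ K) z (1, 0) (0, u) = 0 := fun u ↦ by
    rw [(hK.isSymmSndFDerivAt (by simpa using two_le_infty)).eq]; exact hmix u
  rw [coordRicci_apply, traceL_prod]
  have h1 : (curvature (cyl K) z (1, 0) (1, 0) (0, w)).1 = 0 := by
    simp [curvature_apply]
  have h2 : (ContinuousLinearMap.snd ℝ ℝ E) ∘L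
      (((curvature (cyl K) z).flip (1, 0)).flip (0, w)) ∘L (ContinuousLinearMap.inr ℝ ℝ E) = 0 := by
    ext u
    refine ext_of_isInvertible hi fun x ↦ ?_
    have e1 := apply_fderiv_christoffel_cyl_snd hK hi (0, u) (1, 0) (0, w) x
    have e2 := apply_fderiv_christoffel_cyl_snd hK hi (1, 0) (0, u) (0, w) x
    simp only [hl, h0, hmix, hmix', Prod.snd_zero, map_zero, zero_apply, add_zero, sub_zero,
      mul_zero] at e1 e2
    simp [curvature_apply, hl, e1, e2]
  simp only [flip_apply] at h1 h2 ⊢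
  rw [h1, h2, map_zero, zero_add]

theorem coordRicci_cyl_mixed_right (v : E) : coordRicci (cyl K) z (0, v) (1, 0) = 0 := by
  have hr := christoffel_cyl_partialT_right hK hi h0
  have hl := christoffel_cyl_partialT_left hK hi h0
  rw [coordRicci_apply, traceL_prod]
  have h1 : (curvature (cyl K) z (1, 0) (0, v) (1, 0)).1 = 0 := by
    simp [curvature_apply, hl, hr, fderiv_christoffel_cyl_fst hK hi]
  have h2 : (ContinuousLinearMap.snd ℝ ℝ E) ∘L
      (((curvature (cyl K) z).flip (0, v)).flip (1, 0)) ∘L (ContinuousLinearMap.inr ℝ ℝ E) = 0 := by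
    ext u
    refine ext_of_isInvertible hi fun x ↦ ?_
    have e1 := apply_fderiv_christoffel_cyl_snd hK hi (0, u) (0, v) (1, 0) x
    have e2 := apply_fderiv_christoffel_cyl_snd hK hi (0, v) (0, u) (1, 0) x
    simp only [hr, hmix, Prod.snd_zero, map_zero, zero_apply, add_zero, sub_zero, mul_zero] at e1 e2
    simp [curvature_apply, hr, e1, e2]
  simp only [flip_apply] at h1 h2 ⊢
  rw [h1, h2, map_zero, zero_add]

end Curvature
end CylinderCoordinates

section Charts

variable {E : Type*} [NormedAddCommGroup E] [NormedSpace ℝ E]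
  {H : Type*} [TopologicalSpace H] {I : ModelWithCorners ℝ E H}
  {M : Type*} [TopologicalSpace M] [ChartedSpace H M]

/-- A field of bilinear forms in the preferred chart at `x`. -/
def chartExpr (B : ∀ q : M, TangentSpace I q →L[ℝ] TangentSpace I q →L[ℝ] ℝ) (x : M) (y : E) :
    E →L[ℝ] E →L[ℝ] ℝ :=
  let q : M := (extChartAt I x).symm y
  let A : E →L[ℝ] E := mfderiv 𝓘(ℝ, E) I (extChartAt I x).symm y
  let C : E →L[ℝ] E →L[ℝ] ℝ := B q
  C.bilinearComp A A

variable (I) in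
/-- The transition map from the preferred chart at `x` to the one at `x'`. -/
def transition (x x' : M) (y : E) : E := extChartAt I x' ((extChartAt I x).symm y)

variable [IsManifold I ∞ M]

theorem inChart_eq_chartExpr (g : Metric I M) (x : M) : inChart g x = chartExpr g.inner x := rfl

variable [I.Boundaryless] {x x' x'' : M} {y : E}

theorem mfderiv_extChartAt_symm_eq (hy : y ∈ (extChartAt I x).target) :
    mfderiv 𝓘(ℝ, E) I (extChartAt I x).symm y =
      fderiv ℝ (transition I x ((extChartAt I x).symm y)) y := by
  have hmd : MDifferentiableAt 𝓘(ℝ, E) I (extChartAt I x).symm y :=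
    ((contMDiffOn_extChartAt_symm (n := ∞) x).contMDiffAt
      ((isOpen_extChartAt_target x).mem_nhds hy)).mdifferentiableAt (by simp)
  refine hmd.mfderiv.trans ?_
  simp only [writtenInExtChartAt, extChartAt_model_space_eq_id, modelWithCornersSelf_coe,
    Set.range_id, fderivWithin_univ]
  rfl

theorem contDiffAt_transition (hy : y ∈ (extChartAt I x).target)
    (hy' : (extChartAt I x).symm y ∈ (chartAt H x').source) :
    ContDiffAt ℝ ∞ (transition I x x') y := by
  have h1 : ContMDiffAt 𝓘(ℝ, E) I ∞ (extChartAt I x).symm y :=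
    (contMDiffOn_extChartAt_symm (n := ∞) x).contMDiffAt
      ((isOpen_extChartAt_target x).mem_nhds hy)
  have h2 : ContMDiffAt I 𝓘(ℝ, E) ∞ (extChartAt I x') ((extChartAt I x).symm y) :=
    contMDiffAt_extChartAt' hy'
  exact contMDiffAt_iff_contDiffAt.1 (h2.comp y h1)

omit [IsManifold I ∞ M] in
theorem eventually_transition_domain (hy : y ∈ (extChartAt I x).target)
    (hy' : (extChartAt I x).symm y ∈ (chartAt H x').source) :
    ∀ᶠ z in 𝓝 y, z ∈ (extChartAt I x).target ∧
      (extChartAt I x).symm z ∈ (chartAt H x').source := by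
  refine ((isOpen_extChartAt_target x).eventually_mem hy).and ?_
  exact ((continuousOn_extChartAt_symm x).continuousAt
    ((isOpen_extChartAt_target x).mem_nhds hy)).eventually
      ((chartAt H x').open_source.eventually_mem hy')

omit [IsManifold I ∞ M] [I.Boundaryless] in
theorem symm_transition (hy' : (extChartAt I x).symm y ∈ (chartAt H x').source) :
    (extChartAt I x').symm (transition I x x' y) = (extChartAt I x).symm y :=
  (extChartAt I x').left_inv (by rwa [extChartAt_source])

omit [IsManifold I ∞ M] [I.Boundaryless] in
theorem transition_mem_target (hy' : (extChartAt I x).symm y ∈ (chartAt H x').source) :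
    transition I x x' y ∈ (extChartAt I x').target :=
  (extChartAt I x').map_source (by rwa [extChartAt_source])

theorem fderiv_transition_comp (hy : y ∈ (extChartAt I x).target)
    (hy' : (extChartAt I x).symm y ∈ (chartAt H x').source)
    (hy'' : (extChartAt I x).symm y ∈ (chartAt H x'').source) :
    fderiv ℝ (transition I x x'') y =
      fderiv ℝ (transition I x' x'') (transition I x x' y) ∘L fderiv ℝ (transition I x x') y := by
  have h1 := ((contDiffAt_transition hy hy').differentiableAt (by simp)).hasFDerivAt
  have h2 := ((contDiffAt_transition (x' := x'') (transition_mem_target hy')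
    (by rwa [symm_transition hy'])).differentiableAt (by simp)).hasFDerivAt
  refine ((h2.comp y h1).congr_of_eventuallyEq ?_).fderiv
  filter_upwards [eventually_transition_domain hy hy'] with z hz
  simp only [Function.comp_apply]
  rw [transition, transition, symm_transition hz.2]

omit [IsManifold I ∞ M] in
theorem fderiv_transition_self (hy : y ∈ (extChartAt I x).target) :
    fderiv ℝ (transition I x x) y = ContinuousLinearMap.id ℝ E := by
  rw [← fderiv_id (𝕜 := ℝ) (x := y)]
  refine Filter.EventuallyEq.fderiv_eq ?_
  filter_upwards [(isOpen_extChartAt_target x).mem_nhds hy] with z hz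
  exact (extChartAt I x).right_inv hz

theorem isInvertible_fderiv_transition (hy : y ∈ (extChartAt I x).target)
    (hy' : (extChartAt I x).symm y ∈ (chartAt H x').source) :
    (fderiv ℝ (transition I x x') y).IsInvertible := by
  have hs : (extChartAt I x).symm y ∈ (chartAt H x).source := by
    rw [← extChartAt_source I]; exact (extChartAt I x).map_target hy
  have hr : transition I x' x (transition I x x' y) = y := by
    rw [transition, symm_transition hy', (extChartAt I x).right_inv hy]
  refine ContinuousLinearMap.IsInvertible.of_inverse
    (g := fderiv ℝ (transition I x' x) (transition I x x' y)) ?_ ?_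
  · have := fderiv_transition_comp (x := x') (x' := x) (x'' := x') (transition_mem_target hy')
      (by rwa [symm_transition hy']) (by rwa [symm_transition hy'])
    rw [hr, fderiv_transition_self (transition_mem_target hy')] at this
    exact this.symm
  · have := fderiv_transition_comp (x' := x') hy hy' hs
    rw [fderiv_transition_self hy] at this
    exact this.symm

theorem chartExpr_apply (B : ∀ q : M, TangentSpace I q →L[ℝ] TangentSpace I q →L[ℝ] ℝ)
    (hy : y ∈ (extChartAt I x).target) (u v : E) :
    chartExpr B x y u v = B ((extChartAt I x).symm y)
      (fderiv ℝ (transition I x ((extChartAt I x).symm y)) y u)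
      (fderiv ℝ (transition I x ((extChartAt I x).symm y)) y v) := by
  rw [← mfderiv_extChartAt_symm_eq hy]
  rfl

theorem chartExpr_self (B : ∀ q : M, TangentSpace I q →L[ℝ] TangentSpace I q →L[ℝ] ℝ) (x : M) :
    chartExpr B x (extChartAt I x x) = B x := by
  refine ContinuousLinearMap.ext fun u ↦ ContinuousLinearMap.ext fun v ↦ ?_
  have := chartExpr_apply B (mem_extChartAt_target (I := I) x) u v
  rw [extChartAt_to_inv, fderiv_transition_self (mem_extChartAt_target x)] at this
  exact this

theorem chartExpr_eq_pullback (B : ∀ q : M, TangentSpace I q →L[ℝ] TangentSpace I q →L[ℝ] ℝ)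
    (hy : y ∈ (extChartAt I x).target)
    (hy' : (extChartAt I x).symm y ∈ (chartAt H x').source) :
    chartExpr B x =ᶠ[𝓝 y] pullback (transition I x x') (chartExpr B x') := by
  filter_upwards [eventually_transition_domain hy hy'] with z hz
  ext u v
  rw [pullback_apply, chartExpr_apply B hz.1, chartExpr_apply B (transition_mem_target hz.2),
    symm_transition hz.2, fderiv_transition_comp hz.1 hz.2 (mem_chart_source H _)]
  rfl

theorem contMDiffAt_bilinear_iff [FiniteDimensional ℝ E]
    {B : ∀ q : M, TangentSpace I q →L[ℝ] TangentSpace I q →L[ℝ] ℝ} :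
    ContMDiffAt I (I.prod 𝓘(ℝ, E →L[ℝ] E →L[ℝ] ℝ)) ∞
      (fun q ↦ Bundle.TotalSpace.mk' (E →L[ℝ] E →L[ℝ] ℝ)
        (E := fun q : M ↦ TangentSpace I q →L[ℝ] TangentSpace I q →L[ℝ] ℝ) q (B q)) x ↔
      ContDiffAt ℝ ∞ (chartExpr B x) (extChartAt I x x) := by
  have : IsManifold I 1 M := IsManifold.of_le (n := ∞) (by simp)
  refine (contMDiffAt_hom_bundle _).trans ((and_iff_right contMDiffAt_id).trans ?_)
  rw [contMDiffAt_iff_source, I.range_eq_univ, contMDiffWithinAt_univ, contMDiffAt_iff_contDiffAt]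
  suffices he : _ =ᶠ[𝓝 (extChartAt I x x)] chartExpr B x from
    ⟨fun h ↦ h.congr_of_eventuallyEq he.symm, fun h ↦ h.congr_of_eventuallyEq he⟩
  filter_upwards [extChartAt_target_mem_nhds (I := I) x] with y hy
  have hs : (extChartAt I x).symm y ∈ (chartAt H x).source := by
    rw [← extChartAt_source I]; exact (extChartAt I x).map_target hy
  ext u v
  simp only [Function.comp_apply]
  rw [inCoordinates_apply_eq₂ (by simpa using hs) (by simpa using hs) (by simp)]
  have key := TangentBundle.symmL_trivializationAt (I := I) hs
  rw [I.range_eq_univ, mfderivWithin_univ, (extChartAt I x).right_inv hy] at key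
  have key' : ∀ w : E, (trivializationAt E (TangentSpace I) x).symm ((extChartAt I x).symm y) w =
      mfderiv 𝓘(ℝ, E) I (extChartAt I x).symm y w := fun w ↦
    ((Bundle.Trivialization.symmL_apply (R := ℝ) _ (by simpa using hs) w).symm.trans
      (congrArg (fun L : E →L[ℝ] E ↦ L w) key))
  rw [key', key']
  simp
  rfl

end Charts

section CylinderCharts

variable {E : Type*} [NormedAddCommGroup E] [NormedSpace ℝ E]
  {N : Type*} [TopologicalSpace N] [ChartedSpace E N]
  {δ : ℝ}

theorem extChartAt_cylinder (p q : interval δ × N) :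
    extChartAt (𝓘(ℝ, ℝ).prod 𝓘(ℝ, E)) p q = ((q.1 : ℝ), extChartAt 𝓘(ℝ, E) p.2 q.2) := by
  rw [extChartAt_prod]
  rfl

theorem mem_source_cylinder (p : interval δ × N) (s : interval δ) {y : E}
    (hy : y ∈ (extChartAt 𝓘(ℝ, E) p.2).target) :
    (s, (extChartAt 𝓘(ℝ, E) p.2).symm y) ∈
      (extChartAt (𝓘(ℝ, ℝ).prod 𝓘(ℝ, E)) p).source := by
  rw [extChartAt_prod]
  refine ⟨?_, (extChartAt 𝓘(ℝ, E) p.2).map_target hy⟩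
  simp [TopologicalSpace.Opens.chartAt_eq, chartAt_self_eq]

theorem mem_target_cylinder (p : interval δ × N) (s : interval δ) {y : E}
    (hy : y ∈ (extChartAt 𝓘(ℝ, E) p.2).target) :
    ((s : ℝ), y) ∈ (extChartAt (𝓘(ℝ, ℝ).prod 𝓘(ℝ, E)) p).target := by
  have h := mem_source_cylinder p s hy
  have h2 := (extChartAt (𝓘(ℝ, ℝ).prod 𝓘(ℝ, E)) p).map_source h
  rwa [extChartAt_cylinder, (extChartAt 𝓘(ℝ, E) p.2).right_inv hy] at h2

theorem extChartAt_cylinder_symm (p : interval δ × N) (s : interval δ) {y : E}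
    (hy : y ∈ (extChartAt 𝓘(ℝ, E) p.2).target) :
    (extChartAt (𝓘(ℝ, ℝ).prod 𝓘(ℝ, E)) p).symm ((s : ℝ), y) =
      (s, (extChartAt 𝓘(ℝ, E) p.2).symm y) := by
  have h := mem_source_cylinder p s hy
  have h2 := (extChartAt (𝓘(ℝ, ℝ).prod 𝓘(ℝ, E)) p).left_inv h
  rwa [extChartAt_cylinder, (extChartAt 𝓘(ℝ, E) p.2).right_inv hy] at h2

omit [NormedSpace ℝ E] in
theorem eventually_mem_cylinder (t : interval δ) {y : E} {U : Set E} (hU : U ∈ 𝓝 y) :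
    ∀ᶠ z in 𝓝 ((t : ℝ), y), z.1 ∈ Set.Ioo (-δ) δ ∧ z.2 ∈ U :=
  prod_mem_nhds (isOpen_Ioo.mem_nhds t.2) hU

theorem fderiv_transition_cylinder [IsManifold 𝓘(ℝ, E) ∞ N] (p p' : interval δ × N)
    (s : interval δ) {y : E} (hy : y ∈ (extChartAt 𝓘(ℝ, E) p.2).target)
    (hy' : (extChartAt 𝓘(ℝ, E) p.2).symm y ∈ (chartAt E p'.2).source) :
    fderiv ℝ (transition (𝓘(ℝ, ℝ).prod 𝓘(ℝ, E)) p p') ((s : ℝ), y) =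
      (ContinuousLinearMap.id ℝ ℝ).prodMap (fderiv ℝ (transition 𝓘(ℝ, E) p.2 p'.2) y) := by
  have h1 := ((contDiffAt_transition (I := 𝓘(ℝ, E)) hy hy').differentiableAt
    (by simp)).hasFDerivAt
  have h2 : HasFDerivAt (Prod.map (id : ℝ → ℝ) (transition 𝓘(ℝ, E) p.2 p'.2)) _ ((s : ℝ), y) :=
    HasFDerivAt.prodMap ((s : ℝ), y) (hasFDerivAt_id (𝕜 := ℝ) (s : ℝ)) h1
  refine (h2.congr_of_eventuallyEq ?_).fderiv
  filter_upwards [eventually_mem_cylinder s ((isOpen_extChartAt_target p.2).mem_nhds hy)]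
    with z hz
  have e : z = (((⟨z.1, hz.1⟩ : interval δ) : ℝ), z.2) := rfl
  rw [e, transition, extChartAt_cylinder_symm p _ hz.2, extChartAt_cylinder]
  rfl

/-- A field of bilinear forms `dt² + C_t` on the cylinder, in a preferred chart. -/
theorem chartExpr_cylinder [IsManifold 𝓘(ℝ, E) ∞ N]
    {B : ∀ q : interval δ × N, TangentSpace (𝓘(ℝ, ℝ).prod 𝓘(ℝ, E)) q →L[ℝ]
      TangentSpace (𝓘(ℝ, ℝ).prod 𝓘(ℝ, E)) q →L[ℝ] ℝ}
    {C : interval δ → ∀ x : N, TangentSpace 𝓘(ℝ, E) x →L[ℝ] TangentSpace 𝓘(ℝ, E) x →L[ℝ] ℝ}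
    (hB : ∀ q a b u v, B q (tangentPair q a u) (tangentPair q b v) = a * b + C q.1 q.2 u v)
    (p : interval δ × N) (s : interval δ) {y : E}
    (hy : y ∈ (extChartAt 𝓘(ℝ, E) p.2).target) (X Y : ℝ × E) :
    chartExpr B p ((s : ℝ), y) X Y = X.1 * Y.1 + chartExpr (C s) p.2 y X.2 Y.2 := by
  rw [chartExpr_apply B (mem_target_cylinder p s hy), chartExpr_apply (C s) hy,
    extChartAt_cylinder_symm p s hy,
    fderiv_transition_cylinder p (s, (extChartAt 𝓘(ℝ, E) p.2).symm y) s hy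
      (mem_chart_source E _)]
  exact hB (s, (extChartAt 𝓘(ℝ, E) p.2).symm y) _ _ _ _

end CylinderCharts

section MetricInChart

variable {E : Type*} [NormedAddCommGroup E] [NormedSpace ℝ E] [FiniteDimensional ℝ E]
  {H : Type*} [TopologicalSpace H] {I : ModelWithCorners ℝ E H} [I.Boundaryless]
  {M : Type*} [TopologicalSpace M] [ChartedSpace H M] [IsManifold I ∞ M]

omit [FiniteDimensional ℝ E] in
theorem inChart_self (g : Metric I M) (x : M) : inChart g x (extChartAt I x x) = g.inner x :=
  chartExpr_self g.inner x

theorem isMetricAt_inChart (g : Metric I M) (x : M) :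
    IsMetricAt (inChart g x) (extChartAt I x x) where
  contDiffAt := contMDiffAt_bilinear_iff.1 (g.contMDiff x)
  symm := Eventually.of_forall fun y u v ↦ by
    rw [inChart_apply, inChart_apply]; exact g.symm _ _ _
  isInvertible := by
    rw [inChart_self]
    exact isInvertible_of_pos (E := E) fun v hv ↦ g.pos x v hv

/-- The Ricci tensor as a field of bilinear forms. -/
def ricciForm (g : Metric I M) (x : M) : TangentSpace I x →L[ℝ] TangentSpace I x →L[ℝ] ℝ :=
  (coordRicci (inChart g x) (extChartAt I x x) : E →L[ℝ] E →L[ℝ] ℝ)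

theorem chartExpr_ricciForm (g : Metric I M) (x : M) {y : E} (hy : y ∈ (extChartAt I x).target) :
    chartExpr (ricciForm g) x y = coordRicci (inChart g x) y := by
  have hy' := mem_chart_source H ((extChartAt I x).symm y)
  ext v w
  rw [chartExpr_apply _ hy]
  exact (coordRicci_pullback (chartExpr_eq_pullback g.inner hy hy')
    (isMetricAt_inChart g _) (contDiffAt_transition hy hy')
    (isInvertible_fderiv_transition hy hy') v w).symm

theorem scal_extChartAt_symm (g : Metric I M) (x : M) {y : E} (hy : y ∈ (extChartAt I x).target) :
    scal g ((extChartAt I x).symm y) = coordScal (inChart g x) y := by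
  have hy' := mem_chart_source H ((extChartAt I x).symm y)
  exact (coordScal_pullback (chartExpr_eq_pullback g.inner hy hy')
    (isMetricAt_inChart g _) (contDiffAt_transition hy hy')
    (isInvertible_fderiv_transition hy hy')).symm

end MetricInChart

section Necessity

variable {E : Type*} [NormedAddCommGroup E] [NormedSpace ℝ E] [FiniteDimensional ℝ E]
  {N : Type*} [TopologicalSpace N] [ChartedSpace E N] [IsManifold 𝓘(ℝ, E) ∞ N] {δ : ℝ}

omit [FiniteDimensional ℝ E] in
theorem sliceII_eq_christoffel_fst {g : CylinderMetric E δ N} {gt : interval δ → Metric 𝓘(ℝ, E) N}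
    (hg : IsCylindrical g gt) (p : interval δ × N) (u v : TangentSpace 𝓘(ℝ, E) p.2) :
    sliceII g p u v = (christoffel (inChart g p)
      (extChartAt (𝓘(ℝ, ℝ).prod 𝓘(ℝ, E)) p p) (0, u) (0, v)).1 := by
  have h := hg p (christoffel (inChart g p)
      (extChartAt (𝓘(ℝ, ℝ).prod 𝓘(ℝ, E)) p p) (0, u) (0, v)).1 1 (christoffel (inChart g p)
      (extChartAt (𝓘(ℝ, ℝ).prod 𝓘(ℝ, E)) p p) (0, u) (0, v)).2 0
  rw [map_zero, add_zero, mul_one] at h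
  exact h

theorem neg_le_scal_of_cylinder {ε : ℝ} {gN : Metric 𝓘(ℝ, E) N} (t : interval δ)
    {g : CylinderMetric E δ N} {gt : interval δ → Metric 𝓘(ℝ, E) N} (hg : IsCylindrical g gt)
    (hpos : PositiveRicci g) (hgeod : SliceTotallyGeodesic g t) (ht : gt t = gN) (x : N)
    (hε : ricci g (t, x) (partialT (t, x)) (partialT (t, x)) = ε) : 0 ≤ scal gN x + ε := by
  set p : interval δ × N := (t, x) with hp
  set y : E := extChartAt 𝓘(ℝ, E) x x with hy
  have hz : extChartAt (𝓘(ℝ, ℝ).prod 𝓘(ℝ, E)) p p = ((t : ℝ), y) := extChartAt_cylinder p p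
  let K : ℝ × E → E →L[ℝ] E →L[ℝ] ℝ := fun z ↦
    (inChart g p z).bilinearComp (.inr ℝ ℝ E) (.inr ℝ ℝ E)
  have hKapp : ∀ z u v, K z u v = inChart g p z (0, u) (0, v) := fun _ _ _ ↦ rfl
  have hchart : ∀ (s : interval δ) {y' : E}, y' ∈ (extChartAt 𝓘(ℝ, E) x).target → ∀ X Y,
      inChart g p ((s : ℝ), y') X Y = X.1 * Y.1 + inChart (gt s) x y' X.2 Y.2 :=
    fun s y' hy' X Y ↦ chartExpr_cylinder (B := g.inner) (C := fun s ↦ (gt s).inner) hg p s hy' X Y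
  have hytgt : y ∈ (extChartAt 𝓘(ℝ, E) x).target := mem_extChartAt_target x
  have hK0 : ∀ {y' : E}, y' ∈ (extChartAt 𝓘(ℝ, E) x).target → K ((t : ℝ), y') = inChart gN x y' := by
    intro y' hy'
    ext u v
    rw [hKapp, hchart t hy', ht]
    simp
  have hcyl : inChart g p =ᶠ[𝓝 ((t : ℝ), y)] cyl K := by
    filter_upwards [eventually_mem_cylinder t (extChartAt_target_mem_nhds (I := 𝓘(ℝ, E)) x)]
      with z hz
    refine ContinuousLinearMap.ext fun X ↦ ContinuousLinearMap.ext fun Y ↦ ?_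
    have e : z = (((⟨z.1, hz.1⟩ : interval δ) : ℝ), z.2) := rfl
    rw [cyl_apply, hKapp, e, hchart _ hz.2, hchart _ hz.2]
    simp
  have hKs : ContDiffAt ℝ ∞ K ((t : ℝ), y) := by
    have := (isMetricAt_inChart g p).contDiffAt
    rw [hz] at this
    exact contDiffAt_flip ((contDiffAt_flip (this.clm_comp contDiffAt_const)).clm_comp
      contDiffAt_const)
  have hKz : K ((t : ℝ), y) = gN.inner x := (hK0 hytgt).trans (inChart_self gN x)
  have hKpos : ∀ v, v ≠ 0 → 0 < K ((t : ℝ), y) v v := fun v hv ↦ by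
    rw [hKz]; exact gN.pos x v hv
  have hKsymm : ∀ u v, K ((t : ℝ), y) u v = K ((t : ℝ), y) v u := fun u v ↦ by
    rw [hKz]; exact gN.symm x u v
  have hi := isInvertible_of_pos hKpos
  have h0 : fderiv ℝ K ((t : ℝ), y) (1, 0) = 0 := by
    ext u v
    have := (sliceII_eq_christoffel_fst hg p u v).symm.trans (hgeod x u v)
    rw [hz, christoffel_congr hcyl, christoffel_cyl_fst (hKs.of_le (by simp)) hi] at this
    simpa using this
  have hn := coordRicci_cyl_normal hKs hi h0
  have hε' : coordRicci (cyl K) ((t : ℝ), y) (1, 0) (1, 0) = ε := by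
    rw [← hε, ← coordRicci_congr hcyl, ← hz]; rfl
  have hslice : (fun y' ↦ K ((t : ℝ), y')) =ᶠ[𝓝 y] inChart gN x := by
    filter_upwards [extChartAt_target_mem_nhds (I := 𝓘(ℝ, E)) x] with y' hy' using hK0 hy'
  have hP : ∀ v, v ≠ 0 → 0 < (coordRicci (inChart gN x) y
      - (1 / 2 : ℝ) • fderiv ℝ (fderiv ℝ K) ((t : ℝ), y) (1, 0) (1, 0)) v v := by
    intro v hv
    have h1 := coordRicci_cyl_tangential hKs hi h0 v v
    rw [coordRicci_congr hslice, ← coordRicci_congr hcyl, ← hz] at h1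
    have h2 : 0 < coordRicci (inChart g p) (extChartAt (𝓘(ℝ, ℝ).prod 𝓘(ℝ, E)) p p)
        ((0 : ℝ), v) ((0 : ℝ), v) :=
      hpos p (((0 : ℝ), v) : ℝ × E) fun h ↦ hv (congrArg Prod.snd h)
    rw [h1] at h2
    exact h2
  have htr := traceL_inverse_comp_nonneg hKsymm hKpos hP
  have hsc : scal gN x =
      traceL E (ContinuousLinearMap.inverse (K ((t : ℝ), y)) ∘L coordRicci (inChart gN x) y) := by
    rw [hK0 hytgt]; rfl
  rw [ContinuousLinearMap.comp_sub, map_sub, ContinuousLinearMap.comp_smul, map_smul,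
    smul_eq_mul] at htr
  linarith

end Necessity

section Positivity

variable {V : Type*} [NormedAddCommGroup V] [NormedSpace ℝ V] [FiniteDimensional ℝ V]

theorem exists_mul_sq_le_of_pos {B : V →L[ℝ] V →L[ℝ] ℝ} (hB : ∀ v, v ≠ 0 → 0 < B v v) :
    ∃ c > 0, ∀ v, c * ‖v‖ ^ 2 ≤ B v v := by
  have : ProperSpace V := FiniteDimensional.proper_real V
  rcases (Metric.sphere (0 : V) 1).eq_empty_or_nonempty with h | h
  · have hV : ∀ v : V, v = 0 := fun v ↦ by
      by_contra hv
      have : ‖v‖⁻¹ • v ∈ Metric.sphere (0 : V) 1 := by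
        simp [norm_smul, hv]
      rw [h] at this
      exact this
    exact ⟨1, one_pos, fun v ↦ by simp [hV v]⟩
  · obtain ⟨w, hw, hmin⟩ := (isCompact_sphere (0 : V) 1).exists_isMinOn h
      (f := fun v ↦ B v v) (by fun_prop)
    have hw0 : w ≠ 0 := by
      rintro rfl
      simp at hw
    refine ⟨B w w, hB w hw0, fun v ↦ ?_⟩
    rcases eq_or_ne v 0 with rfl | hv
    · simp
    have hmem : ‖v‖⁻¹ • v ∈ Metric.sphere (0 : V) 1 := by simp [norm_smul, hv]
    have h1 : B w w ≤ B (‖v‖⁻¹ • v) (‖v‖⁻¹ • v) := hmin hmem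
    have hn : 0 < ‖v‖ := norm_pos_iff.2 hv
    simp only [map_smul, smul_apply, smul_eq_mul] at h1
    calc B w w * ‖v‖ ^ 2 ≤ (‖v‖⁻¹ * (‖v‖⁻¹ * B v v)) * ‖v‖ ^ 2 := by gcongr
      _ = B v v := by field_simp

theorem eventually_pos {X : Type*} [TopologicalSpace X] {f : X → V →L[ℝ] V →L[ℝ] ℝ} {x : X}
    (hf : ContinuousAt f x) (hx : ∀ v, v ≠ 0 → 0 < f x v v) :
    ∀ᶠ z in 𝓝 x, ∀ v, v ≠ 0 → 0 < f z v v := by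
  obtain ⟨c, hc, hcv⟩ := exists_mul_sq_le_of_pos hx
  filter_upwards [Metric.continuousAt_iff'.1 hf c hc] with z hz v hv
  rw [dist_eq_norm] at hz
  have h1 : |(f z - f x) v v| ≤ ‖f z - f x‖ * ‖v‖ * ‖v‖ := (f z - f x).le_opNorm₂ v v
  have hn : 0 < ‖v‖ := norm_pos_iff.2 hv
  have h2 : ‖f z - f x‖ * ‖v‖ * ‖v‖ < c * ‖v‖ ^ 2 := by
    rw [mul_assoc, ← sq]
    exact mul_lt_mul_of_pos_right hz (by positivity)
  have h3 := (abs_le.1 h1).1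
  simp only [sub_apply] at h3
  linarith [hcv v]

theorem isVonNBounded_of_pos {B : V →L[ℝ] V →L[ℝ] ℝ} (hB : ∀ v, v ≠ 0 → 0 < B v v) :
    Bornology.IsVonNBounded ℝ {v : V | B v v < 1} := by
  obtain ⟨c, hc, hcv⟩ := exists_mul_sq_le_of_pos hB
  rw [NormedSpace.isVonNBounded_iff, isBounded_iff_forall_norm_le]
  refine ⟨√(1 / c), fun v hv ↦ Real.le_sqrt_of_sq_le ?_⟩
  rw [le_div_iff₀ hc, mul_comm]
  exact (hcv v).trans (le_of_lt hv)

end Positivity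

section QuadraticFamily

variable {E : Type*} [NormedAddCommGroup E] [NormedSpace ℝ E]
  {G H : E → E →L[ℝ] E →L[ℝ] ℝ} {z : ℝ × E} {y : E}

/-- The family `G + s² H` of bilinear forms. -/
def quadFamily (G H : E → E →L[ℝ] E →L[ℝ] ℝ) (z : ℝ × E) : E →L[ℝ] E →L[ℝ] ℝ :=
  G z.2 + z.1 ^ 2 • H z.2

@[simp] theorem quadFamily_apply (G H : E → E →L[ℝ] E →L[ℝ] ℝ) (z : ℝ × E) (u v : E) :
    quadFamily G H z u v = G z.2 u v + z.1 ^ 2 * H z.2 u v := rfl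

theorem contDiffAt_quadFamily {n : WithTop ℕ∞} (hG : ContDiffAt ℝ n G z.2)
    (hH : ContDiffAt ℝ n H z.2) : ContDiffAt ℝ n (quadFamily G H) z := by
  have h1 : ContDiffAt ℝ n (fun z : ℝ × E ↦ G z.2) z := hG.comp z contDiffAt_snd
  have h2 : ContDiffAt ℝ n (fun z : ℝ × E ↦ H z.2) z := hH.comp z contDiffAt_snd
  exact h1.add ((contDiffAt_fst.pow 2).smul h2)

theorem fderiv_quadFamily (hG : DifferentiableAt ℝ G z.2) (hH : DifferentiableAt ℝ H z.2) :
    fderiv ℝ (quadFamily G H) z (1, 0) = (2 * z.1) • H z.2 := by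
  have h1 : HasFDerivAt (fun z : ℝ × E ↦ G z.2) _ z := hG.hasFDerivAt.comp z hasFDerivAt_snd
  have h2 : HasFDerivAt (fun z : ℝ × E ↦ H z.2) _ z := hH.hasFDerivAt.comp z hasFDerivAt_snd
  have hf : HasFDerivAt (Prod.fst : ℝ × E → ℝ) (ContinuousLinearMap.fst ℝ ℝ E) z := hasFDerivAt_fst
  have h3 : HasFDerivAt (fun z : ℝ × E ↦ z.1 ^ 2) _ z := hf.pow 2
  have h : HasFDerivAt (quadFamily G H) _ z := h1.add (h3.smul h2)
  rw [h.fderiv]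
  simp

theorem fderiv_fderiv_quadFamily (hG : ContDiffAt ℝ ∞ G y) (hH : ContDiffAt ℝ ∞ H y)
    (X : ℝ × E) :
    fderiv ℝ (fderiv ℝ (quadFamily G H)) (0, y) X (1, 0) = (2 * X.1) • H y := by
  have hK : ContDiffAt ℝ ∞ (quadFamily G H) (0, y) := contDiffAt_quadFamily hG hH
  have L := ((hK.fderiv_right (m := ∞) (by simp)).differentiableAt (by simp)).hasFDerivAt.clm_apply
    (hasFDerivAt_const ((1 : ℝ), (0 : E)) ((0 : ℝ), y))
  have h2 : HasFDerivAt (fun z : ℝ × E ↦ H z.2) _ ((0 : ℝ), y) :=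
    HasFDerivAt.comp ((0 : ℝ), y) (hH.differentiableAt (by simp)).hasFDerivAt hasFDerivAt_snd
  have hf : HasFDerivAt (Prod.fst : ℝ × E → ℝ) (ContinuousLinearMap.fst ℝ ℝ E) ((0 : ℝ), y) :=
    hasFDerivAt_fst
  have h3 : HasFDerivAt (fun z : ℝ × E ↦ 2 * z.1) _ ((0 : ℝ), y) := hf.const_mul 2
  have R := h3.smul h2
  have hsnd : Tendsto (Prod.snd : ℝ × E → E) (𝓝 (0, y)) (𝓝 y) := continuous_snd.tendsto _
  have he : (fun q ↦ fderiv ℝ (quadFamily G H) q (1, 0)) =ᶠ[𝓝 (0, y)]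
      fun q ↦ (2 * q.1) • H q.2 := by
    filter_upwards [hsnd.eventually ((hG.of_le (m := 1) (by simp)).eventually (by simp)),
      hsnd.eventually ((hH.of_le (m := 1) (by simp)).eventually (by simp))] with q h1 h2
    exact fderiv_quadFamily (h1.differentiableAt (by norm_num)) (h2.differentiableAt (by norm_num))
  have := congrArg (fun L ↦ L X) (L.unique (R.congr_of_eventuallyEq he))
  simpa using this

variable [FiniteDimensional ℝ E] (hG : ContDiffAt ℝ ∞ G y) (hH : ContDiffAt ℝ ∞ H y)
  (hi : (G y).IsInvertible)

omit [FiniteDimensional ℝ E] in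
theorem quadFamily_zero (G H : E → E →L[ℝ] E →L[ℝ] ℝ) (y : E) :
    quadFamily G H (0, y) = G y := by simp [quadFamily]

include hG hH hi

theorem christoffel_cyl_quadFamily_fst (u v : E) :
    (christoffel (cyl (quadFamily G H)) (0, y) (0, u) (0, v)).1 = 0 := by
  rw [christoffel_cyl_fst ((contDiffAt_quadFamily hG hH).of_le (by simp))
    (by rwa [quadFamily_zero]), fderiv_quadFamily (hG.differentiableAt (by simp))
    (hH.differentiableAt (by simp))]
  simp

theorem coordRicci_cyl_quadFamily (a b : ℝ) (u v : E) :
    coordRicci (cyl (quadFamily G H)) (0, y) (a, u) (b, v) =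
      -(a * b * traceL E (ContinuousLinearMap.inverse (G y) ∘L H y))
        + (coordRicci G y u v - H y u v) := by
  have hK : ContDiffAt ℝ ∞ (quadFamily G H) (0, y) := contDiffAt_quadFamily hG hH
  have hi' : (quadFamily G H (0, y)).IsInvertible := by rwa [quadFamily_zero]
  have h0 : fderiv ℝ (quadFamily G H) (0, y) (1, 0) = 0 := by
    rw [fderiv_quadFamily (hG.differentiableAt (by simp)) (hH.differentiableAt (by simp))]
    simp
  have h2 := fderiv_fderiv_quadFamily hG hH
  have hmix : ∀ u, fderiv ℝ (fderiv ℝ (quadFamily G H)) (0, y) (0, u) (1, 0) = 0 := fun u ↦ by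
    rw [h2]; simp
  have e : ∀ (c : ℝ) (w : E), ((c, w) : ℝ × E) = c • ((1 : ℝ), (0 : E)) + (0, w) := fun c w ↦ by
    simp
  rw [e a u, e b v]
  simp only [map_add, map_smul, add_apply, smul_apply, coordRicci_cyl_normal hK hi' h0,
    coordRicci_cyl_mixed_left hK hi' h0 hmix, coordRicci_cyl_mixed_right hK hi' h0 hmix,
    coordRicci_cyl_tangential hK hi' h0, h2]
  simp only [quadFamily_zero, mul_one, ContinuousLinearMap.comp_smul, map_smul, smul_eq_mul]
  ring

end QuadraticFamily

section Sufficiency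

variable {E : Type*} [NormedAddCommGroup E] [NormedSpace ℝ E] [FiniteDimensional ℝ E]
  {N : Type*} [TopologicalSpace N] [ChartedSpace E N] [IsManifold 𝓘(ℝ, E) ∞ N]

/-- The symmetrized Ricci tensor, corrected by a multiple of the metric to have trace `-ε`. -/
def correctedRicci (gN : Metric 𝓘(ℝ, E) N) (ε : ℝ) (x : N) :
    TangentSpace 𝓘(ℝ, E) x →L[ℝ] TangentSpace 𝓘(ℝ, E) x →L[ℝ] ℝ :=
  let R : E →L[ℝ] E →L[ℝ] ℝ := ricciForm gN x
  let G : E →L[ℝ] E →L[ℝ] ℝ := gN.inner x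
  ((1 / 2 : ℝ) • (R + R.flip) - ((ε + scal gN x) / Module.finrank ℝ E) • G : E →L[ℝ] E →L[ℝ] ℝ)

variable (gN : Metric 𝓘(ℝ, E) N) (ε : ℝ)

theorem correctedRicci_apply (x : N) (u v : TangentSpace 𝓘(ℝ, E) x) :
    correctedRicci gN ε x u v = (1 / 2 : ℝ) * (ricciForm gN x u v + ricciForm gN x v u)
      - (ε + scal gN x) / Module.finrank ℝ E * gN.inner x u v := rfl

theorem correctedRicci_symm (x : N) (u v : TangentSpace 𝓘(ℝ, E) x) :
    correctedRicci gN ε x u v = correctedRicci gN ε x v u := by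
  rw [correctedRicci_apply, correctedRicci_apply, gN.symm x u v, add_comm (ricciForm gN x u v)]

theorem contDiffAt_correctedRicci (x : N) :
    ContDiffAt ℝ ∞ (chartExpr (correctedRicci gN ε) x) (extChartAt 𝓘(ℝ, E) x x) := by
  have hg := isMetricAt_inChart gN x
  have hR := contDiffAt_coordRicci (m := ∞) hg.contDiffAt hg.isInvertible (by simp)
  have hS := contDiffAt_coordScal (m := ∞) hg.contDiffAt hg.isInvertible (by simp)
  have h : ContDiffAt ℝ ∞ (fun y ↦ (1 / 2 : ℝ) • (coordRicci (inChart gN x) y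
      + (coordRicci (inChart gN x) y).flip)
      - ((ε + coordScal (inChart gN x) y) / Module.finrank ℝ E) • inChart gN x y)
      (extChartAt 𝓘(ℝ, E) x x) :=
    ((hR.add (contDiffAt_flip hR)).const_smul _).sub
      (((contDiffAt_const.add hS).div_const _).smul hg.contDiffAt)
  refine h.congr_of_eventuallyEq ?_
  filter_upwards [extChartAt_target_mem_nhds (I := 𝓘(ℝ, E)) x] with y hy
  ext u v
  rw [← chartExpr_ricciForm gN x hy, ← scal_extChartAt_symm gN x hy]
  rfl

/-- The metric `g_N + s² h` in the preferred chart at `x`, where `h` is the corrected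
Ricci tensor. -/
def familyInChart (x : N) : ℝ × E → E →L[ℝ] E →L[ℝ] ℝ :=
  quadFamily (inChart gN x) (chartExpr (correctedRicci gN ε) x)

theorem familyInChart_self (s : ℝ) (x : N) (u v : E) :
    familyInChart gN ε x (s, extChartAt 𝓘(ℝ, E) x x) u v =
      gN.inner x u v + s ^ 2 * correctedRicci gN ε x u v := by
  rw [familyInChart, quadFamily_apply, inChart_self, chartExpr_self]
  rfl

theorem contDiffAt_familyInChart (s : ℝ) (x : N) :
    ContDiffAt ℝ ∞ (familyInChart gN ε x) (s, extChartAt 𝓘(ℝ, E) x x) :=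
  contDiffAt_quadFamily (isMetricAt_inChart gN x).contDiffAt (contDiffAt_correctedRicci gN ε x)

omit [FiniteDimensional ℝ E] [IsManifold 𝓘(ℝ, E) ∞ N] in
theorem chartExpr_symm {B : ∀ q : N, TangentSpace 𝓘(ℝ, E) q →L[ℝ] TangentSpace 𝓘(ℝ, E) q →L[ℝ] ℝ}
    (hB : ∀ q u v, B q u v = B q v u) (x : N) (y u v : E) :
    chartExpr B x y u v = chartExpr B x y v u :=
  hB ((extChartAt 𝓘(ℝ, E) x).symm y) (mfderiv 𝓘(ℝ, E) 𝓘(ℝ, E) (extChartAt 𝓘(ℝ, E) x).symm y u)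
    (mfderiv 𝓘(ℝ, E) 𝓘(ℝ, E) (extChartAt 𝓘(ℝ, E) x).symm y v)

theorem familyInChart_symm (x : N) (z : ℝ × E) (u v : E) :
    familyInChart gN ε x z u v = familyInChart gN ε x z v u := by
  rw [familyInChart, quadFamily_apply, quadFamily_apply, inChart_eq_chartExpr,
    chartExpr_symm gN.symm x z.2 u v, chartExpr_symm (correctedRicci_symm gN ε) x z.2 u v]

theorem traceL_correctedRicci (hE : 1 ≤ Module.finrank ℝ E) (x : N) :
    traceL E (ContinuousLinearMap.inverse (inChart gN x (extChartAt 𝓘(ℝ, E) x x)) ∘L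
      chartExpr (correctedRicci gN ε) x (extChartAt 𝓘(ℝ, E) x x)) = -ε := by
  set y := extChartAt 𝓘(ℝ, E) x x
  have hg : IsMetricAt (inChart gN x) y := isMetricAt_inChart gN x
  have hpos : ∀ v, v ≠ 0 → 0 < inChart gN x y v v := fun v hv ↦ by
    rw [inChart_self]; exact gN.pos x v hv
  have hm : (Module.finrank ℝ E : ℝ) ≠ 0 := by positivity
  have e : chartExpr (correctedRicci gN ε) x y = (1 / 2 : ℝ) • (coordRicci (inChart gN x) y
      + (coordRicci (inChart gN x) y).flip)
      - ((ε + scal gN x) / Module.finrank ℝ E) • inChart gN x y := by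
    rw [chartExpr_self, inChart_self]; rfl
  have hs : traceL E (ContinuousLinearMap.inverse (inChart gN x y) ∘L
      coordRicci (inChart gN x) y) = scal gN x := rfl
  rw [e]
  simp only [ContinuousLinearMap.comp_sub, ContinuousLinearMap.comp_smul,
    ContinuousLinearMap.comp_add, map_sub, map_smul, map_add, smul_eq_mul,
    traceL_inverse_comp_flip hg.symm.self_of_nhds hpos, traceL_inverse_comp_self hg.isInvertible,
    hs]
  field_simp
  ring

theorem coordRicci_familyInChart (hE : 1 ≤ Module.finrank ℝ E) (x : N) (a : ℝ) (u : E) :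
    coordRicci (cyl (familyInChart gN ε x)) (0, extChartAt 𝓘(ℝ, E) x x) (a, u) (a, u) =
      a ^ 2 * ε + (ε + scal gN x) / Module.finrank ℝ E * gN.inner x u u := by
  have hg := isMetricAt_inChart gN x
  rw [familyInChart, coordRicci_cyl_quadFamily hg.contDiffAt (contDiffAt_correctedRicci gN ε x)
    hg.isInvertible, traceL_correctedRicci gN ε hE]
  have h1 : chartExpr (correctedRicci gN ε) x (extChartAt 𝓘(ℝ, E) x x) u u = (1 / 2 : ℝ) * (coordRicci (inChart gN x)
      (extChartAt 𝓘(ℝ, E) x x) u u + coordRicci (inChart gN x) (extChartAt 𝓘(ℝ, E) x x) u u)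
      - (ε + scal gN x) / Module.finrank ℝ E * gN.inner x u u := by
    rw [chartExpr_self]; exact correctedRicci_apply gN ε x u u
  rw [h1]
  ring

theorem familyInChart_eq_pullback {x x' : N} {s : ℝ} {y : E}
    (hy : y ∈ (extChartAt 𝓘(ℝ, E) x).target)
    (hy' : (extChartAt 𝓘(ℝ, E) x).symm y ∈ (chartAt E x').source) :
    cyl (familyInChart gN ε x) =ᶠ[𝓝 (s, y)]
      pullback (Prod.map id (transition 𝓘(ℝ, E) x x')) (cyl (familyInChart gN ε x')) := by
  have hsnd : Tendsto (Prod.snd : ℝ × E → E) (𝓝 (s, y)) (𝓝 y) := continuous_snd.tendsto _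
  filter_upwards [hsnd.eventually (chartExpr_eq_pullback gN.inner hy hy'),
    hsnd.eventually (chartExpr_eq_pullback (correctedRicci gN ε) hy hy'),
    hsnd.eventually (eventually_transition_domain (I := 𝓘(ℝ, E)) hy hy')] with z h1 h2 h3
  have hd : HasFDerivAt (Prod.map (id : ℝ → ℝ) (transition 𝓘(ℝ, E) x x')) _ z :=
    HasFDerivAt.prodMap z (hasFDerivAt_id (𝕜 := ℝ) z.1)
      ((contDiffAt_transition (I := 𝓘(ℝ, E)) h3.1 h3.2).differentiableAt (by simp)).hasFDerivAt
  refine ContinuousLinearMap.ext fun X ↦ ContinuousLinearMap.ext fun Y ↦ ?_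
  rw [pullback_apply, hd.fderiv, cyl_apply, cyl_apply]
  simp only [familyInChart, quadFamily_apply, inChart_eq_chartExpr, h1, h2]
  rfl

theorem eventually_familyInChart_pos [CompactSpace N] (hE : 1 ≤ Module.finrank ℝ E) (hε : 0 < ε)
    (hscal : ∀ x, 0 ≤ scal gN x) :
    ∀ᶠ s in 𝓝 (0 : ℝ), ∀ x : N,
      (∀ v, v ≠ 0 → 0 < familyInChart gN ε x (s, extChartAt 𝓘(ℝ, E) x x) v v) ∧
      ∀ X, X ≠ 0 →
        0 < coordRicci (cyl (familyInChart gN ε x)) (s, extChartAt 𝓘(ℝ, E) x x) X X := by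
  suffices h : ∀ x₀ ∈ (Set.univ : Set N), ∀ᶠ p in 𝓝 ((0 : ℝ), x₀),
      (∀ v, v ≠ 0 → 0 < familyInChart gN ε p.2 (p.1, extChartAt 𝓘(ℝ, E) p.2 p.2) v v) ∧
      ∀ X, X ≠ 0 → 0 < coordRicci (cyl (familyInChart gN ε p.2))
        (p.1, extChartAt 𝓘(ℝ, E) p.2 p.2) X X from
    (isCompact_univ.eventually_forall_of_forall_eventually
      (P := fun (s : ℝ) (x : N) ↦
        (∀ v, v ≠ 0 → 0 < familyInChart gN ε x (s, extChartAt 𝓘(ℝ, E) x x) v v) ∧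
        ∀ X, X ≠ 0 → 0 < coordRicci (cyl (familyInChart gN ε x))
          (s, extChartAt 𝓘(ℝ, E) x x) X X) h).mono fun s hs x ↦ hs x (Set.mem_univ x)
  intro x₀ _
  have hpos₀ : ∀ v, v ≠ 0 →
      0 < familyInChart gN ε x₀ ((0 : ℝ), extChartAt 𝓘(ℝ, E) x₀ x₀) v v := fun v hv ↦ by
    rw [familyInChart_self]
    simpa using gN.pos x₀ v hv
  have hm : (0 : ℝ) < Module.finrank ℝ E := by exact_mod_cast hE
  have hric₀ : ∀ X, X ≠ 0 → 0 < coordRicci (cyl (familyInChart gN ε x₀))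
      ((0 : ℝ), extChartAt 𝓘(ℝ, E) x₀ x₀) X X := by
    rintro ⟨a, u⟩ hX
    rw [coordRicci_familyInChart gN ε hE]
    have hc : 0 < (ε + scal gN x₀) / Module.finrank ℝ E :=
      div_pos (by linarith [hscal x₀]) hm
    rcases eq_or_ne u 0 with rfl | hu
    · have ha : a ≠ 0 := fun h ↦ hX (by simp [h])
      have h0 : gN.inner x₀ (0 : E) (0 : E) = 0 := map_zero _
      rw [h0]
      positivity
    · have hu' : 0 < gN.inner x₀ u u := gN.pos x₀ u hu
      positivity
  have hcont : ContinuousAt (fun p : ℝ × N ↦ (p.1, extChartAt 𝓘(ℝ, E) x₀ p.2)) (0, x₀) :=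
    continuousAt_fst.prodMk
      (ContinuousAt.comp (continuousAt_extChartAt x₀) continuousAt_snd)
  have hsm := contDiffAt_familyInChart gN ε 0 x₀
  have hricsm := contDiffAt_coordRicci (m := ∞) (contDiffAt_cyl hsm)
    (isInvertible_cyl (isInvertible_of_pos hpos₀)) (by simp)
  have e1 := hcont.eventually (eventually_pos hsm.continuousAt hpos₀)
  have e2 := hcont.eventually (eventually_pos hricsm.continuousAt hric₀)
  have e3 : ∀ᶠ p : ℝ × N in 𝓝 ((0 : ℝ), x₀), p.2 ∈ (extChartAt 𝓘(ℝ, E) x₀).source :=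
    continuousAt_snd.eventually (extChartAt_source_mem_nhds (I := 𝓘(ℝ, E)) x₀)
  filter_upwards [e1, e2, e3] with ⟨s, x⟩ h1 h2 h3
  simp only at h1 h2 h3 ⊢
  set y := extChartAt 𝓘(ℝ, E) x₀ x with hy
  have hyt : y ∈ (extChartAt 𝓘(ℝ, E) x₀).target := (extChartAt 𝓘(ℝ, E) x₀).map_source h3
  have hyx : (extChartAt 𝓘(ℝ, E) x₀).symm y = x := (extChartAt 𝓘(ℝ, E) x₀).left_inv h3
  have hys : (extChartAt 𝓘(ℝ, E) x₀).symm y ∈ (chartAt E x).source := by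
    rw [hyx]; exact mem_chart_source E x
  set τ := transition 𝓘(ℝ, E) x₀ x
  have hτy : τ y = extChartAt 𝓘(ℝ, E) x x := by
    rw [← congrArg (extChartAt 𝓘(ℝ, E) x) hyx]; rfl
  have hτ : ContDiffAt ℝ ∞ τ y := contDiffAt_transition hyt hys
  have hτi : (fderiv ℝ τ y).IsInvertible := isInvertible_fderiv_transition hyt hys
  have hφ : ContDiffAt ℝ ∞ (Prod.map (id : ℝ → ℝ) τ) (s, y) := contDiffAt_id.prodMap hτ
  have hφd : fderiv ℝ (Prod.map (id : ℝ → ℝ) τ) (s, y) =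
      (ContinuousLinearMap.id ℝ ℝ).prodMap (fderiv ℝ τ y) :=
    (HasFDerivAt.prodMap (s, y) (hasFDerivAt_id (𝕜 := ℝ) s)
      (hτ.differentiableAt (by simp)).hasFDerivAt).fderiv
  have hφi : (fderiv ℝ (Prod.map (id : ℝ → ℝ) τ) (s, y)).IsInvertible := by
    obtain ⟨e, he⟩ := hτi
    rw [hφd, ← he]
    exact ⟨(ContinuousLinearEquiv.refl ℝ ℝ).prodCongr e, rfl⟩
  have hφz : Prod.map (id : ℝ → ℝ) τ (s, y) = (s, extChartAt 𝓘(ℝ, E) x x) := by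
    rw [Prod.map_apply, hτy]; rfl
  have hF : cyl (familyInChart gN ε x₀) =ᶠ[𝓝 (s, y)]
      pullback (Prod.map (id : ℝ → ℝ) τ) (cyl (familyInChart gN ε x)) :=
    familyInChart_eq_pullback gN ε hyt hys
  have hpos : ∀ v, v ≠ 0 → 0 < familyInChart gN ε x (s, extChartAt 𝓘(ℝ, E) x x) v v := by
    intro v hv
    obtain ⟨w, rfl⟩ := hτi.surjective v
    have hw : w ≠ 0 := by rintro rfl; simp at hv
    have h := congrArg (fun L ↦ L ((0 : ℝ), w) ((0 : ℝ), w)) hF.eq_of_nhds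
    simp only [pullback_apply, hφd, hφz] at h
    have h' := h1 w hw
    simp only [cyl_apply, ContinuousLinearMap.coe_prodMap', Prod.map_apply, map_zero, mul_zero,
      zero_add] at h
    rwa [h] at h'
  refine ⟨hpos, fun X hX ↦ ?_⟩
  obtain ⟨W, rfl⟩ := hφi.surjective X
  have hW : W ≠ 0 := by rintro rfl; simp at hX
  have hmet : IsMetricAt (cyl (familyInChart gN ε x)) (Prod.map (id : ℝ → ℝ) τ (s, y)) := by
    rw [hφz]
    exact ⟨contDiffAt_cyl (contDiffAt_familyInChart gN ε s x),
      Eventually.of_forall fun z u v ↦ by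
        rw [cyl_apply, cyl_apply, familyInChart_symm, mul_comm],
      isInvertible_cyl (isInvertible_of_pos hpos)⟩
  have := coordRicci_pullback hF hmet hφ hφi W W
  rw [hφz] at this
  rw [← this]
  exact h2 W hW

end Sufficiency

section Construction

variable {E : Type*} [NormedAddCommGroup E] [NormedSpace ℝ E] [FiniteDimensional ℝ E]
  {N : Type*} [TopologicalSpace N] [ChartedSpace E N] [IsManifold 𝓘(ℝ, E) ∞ N]
  (gN : Metric 𝓘(ℝ, E) N) (ε : ℝ)

/-- The field of bilinear forms `g_N + s² h`, where `h` is the corrected Ricci tensor. -/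
def familyForm (s : ℝ) (x : N) :
    TangentSpace 𝓘(ℝ, E) x →L[ℝ] TangentSpace 𝓘(ℝ, E) x →L[ℝ] ℝ :=
  (familyInChart gN ε x (s, extChartAt 𝓘(ℝ, E) x x) : E →L[ℝ] E →L[ℝ] ℝ)

theorem familyForm_apply (s : ℝ) (x : N) (u v : TangentSpace 𝓘(ℝ, E) x) :
    familyForm gN ε s x u v = gN.inner x u v + s ^ 2 * correctedRicci gN ε x u v :=
  familyInChart_self gN ε s x u v

theorem chartExpr_familyForm (s : ℝ) (x : N) (y : E) :
    chartExpr (familyForm gN ε s) x y = familyInChart gN ε x (s, y) := by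
  ext u v
  exact familyForm_apply gN ε s ((extChartAt 𝓘(ℝ, E) x).symm y)
    (mfderiv 𝓘(ℝ, E) 𝓘(ℝ, E) (extChartAt 𝓘(ℝ, E) x).symm y u)
    (mfderiv 𝓘(ℝ, E) 𝓘(ℝ, E) (extChartAt 𝓘(ℝ, E) x).symm y v)

/-- The metric `g_N + s² h`. -/
def familyMetric (s : ℝ)
    (hpos : ∀ x : N, ∀ v, v ≠ 0 → 0 < familyInChart gN ε x (s, extChartAt 𝓘(ℝ, E) x x) v v) :
    Metric 𝓘(ℝ, E) N where
  inner := familyForm gN ε s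
  symm x u v := familyInChart_symm gN ε x _ u v
  pos x v hv := hpos x v hv
  isVonNBounded x := isVonNBounded_of_pos (V := E) (hpos x)
  contMDiff x := contMDiffAt_bilinear_iff.2 <|
    (ContDiffAt.comp (extChartAt 𝓘(ℝ, E) x x) (contDiffAt_familyInChart gN ε s x)
      (contDiffAt_const.prodMk contDiffAt_id)).congr_of_eventuallyEq <|
      Eventually.of_forall fun y ↦ chartExpr_familyForm gN ε s x y

variable {δ : ℝ}

/-- The field of bilinear forms `dt² + g_N + t² h` on the cylinder. -/
def cylinderForm (p : interval δ × N) : TangentSpace (𝓘(ℝ, ℝ).prod 𝓘(ℝ, E)) p →L[ℝ]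
    TangentSpace (𝓘(ℝ, ℝ).prod 𝓘(ℝ, E)) p →L[ℝ] ℝ :=
  (cyl (familyInChart gN ε p.2) ((p.1 : ℝ), extChartAt 𝓘(ℝ, E) p.2 p.2) :
    ℝ × E →L[ℝ] ℝ × E →L[ℝ] ℝ)

theorem cylinderForm_tangentPair (p : interval δ × N) (a b : ℝ) (u v : TangentSpace 𝓘(ℝ, E) p.2) :
    cylinderForm gN ε p (tangentPair p a u) (tangentPair p b v) =
      a * b + familyForm gN ε p.1 p.2 u v := rfl

theorem chartExpr_cylinderForm (p : interval δ × N) :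
    chartExpr (cylinderForm gN ε) p =ᶠ[𝓝 ((p.1 : ℝ), extChartAt 𝓘(ℝ, E) p.2 p.2)]
      cyl (familyInChart gN ε p.2) := by
  filter_upwards [eventually_mem_cylinder p.1 (extChartAt_target_mem_nhds (I := 𝓘(ℝ, E)) p.2)]
    with z hz
  refine ContinuousLinearMap.ext fun X ↦ ContinuousLinearMap.ext fun Y ↦ ?_
  have e : z = (((⟨z.1, hz.1⟩ : interval δ) : ℝ), z.2) := rfl
  rw [e, chartExpr_cylinder (C := fun s ↦ familyForm gN ε s) (cylinderForm_tangentPair gN ε)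
    p _ hz.2, chartExpr_familyForm, cyl_apply]

omit [FiniteDimensional ℝ E] in
theorem cyl_pos {K : ℝ × E → E →L[ℝ] E →L[ℝ] ℝ} {z : ℝ × E}
    (hK : ∀ v, v ≠ 0 → 0 < K z v v) (X : ℝ × E) (hX : X ≠ 0) : 0 < cyl K z X X := by
  rw [cyl_apply]
  rcases eq_or_ne X.2 0 with h | h
  · have h1 : X.1 ≠ 0 := fun h1 ↦ hX (Prod.ext h1 h)
    rw [h, map_zero, add_zero]
    exact mul_self_pos.2 h1
  · exact add_pos_of_nonneg_of_pos (mul_self_nonneg _) (hK _ h)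

/-- The metric `dt² + g_N + t² h` on the cylinder. -/
def cylinderMetric (hpos : ∀ s : interval δ, ∀ x : N, ∀ v, v ≠ 0 →
    0 < familyInChart gN ε x ((s : ℝ), extChartAt 𝓘(ℝ, E) x x) v v) : CylinderMetric E δ N where
  inner := cylinderForm gN ε
  symm p X Y := by
    change X.1 * Y.1 + familyInChart gN ε p.2 _ X.2 Y.2
      = Y.1 * X.1 + familyInChart gN ε p.2 _ Y.2 X.2
    rw [familyInChart_symm, mul_comm]
  pos p X hX := cyl_pos (hpos p.1 p.2) X hX
  isVonNBounded p := isVonNBounded_of_pos (V := ℝ × E) (cyl_pos (hpos p.1 p.2))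
  contMDiff p := contMDiffAt_bilinear_iff.2 <| by
    rw [extChartAt_cylinder]
    exact (contDiffAt_cyl (contDiffAt_familyInChart gN ε p.1 p.2)).congr_of_eventuallyEq
      (chartExpr_cylinderForm gN ε p)

theorem exists_cylinder_of_scal_nonneg [CompactSpace N] (hE : 1 ≤ Module.finrank ℝ E)
    (hscal : ∀ x, 0 ≤ scal gN x) (hε : 0 < ε) :
    ∃ (δ : ℝ) (hδ : 0 < δ) (g : CylinderMetric E δ N) (gt : interval δ → Metric 𝓘(ℝ, E) N),
      IsCylindrical g gt ∧ PositiveRicci g ∧ SliceTotallyGeodesic g (origin hδ) ∧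
      gt (origin hδ) = gN ∧
      ∀ x : N, ricci g (origin hδ, x) (partialT (origin hδ, x)) (partialT (origin hδ, x)) = ε := by
  obtain ⟨δ, hδ, h⟩ := Metric.eventually_nhds_iff.1
    (eventually_familyInChart_pos gN ε hE hε hscal)
  have hs : ∀ s : interval δ, dist (s : ℝ) 0 < δ := fun s ↦ by
    rw [Real.dist_0_eq_abs]; exact abs_lt.2 s.2
  have hpos := fun (s : interval δ) (x : N) ↦ (h (hs s) x).1
  let g : CylinderMetric E δ N := cylinderMetric gN ε hpos
  have hcyl : IsCylindrical g fun s ↦ familyMetric gN ε s (hpos s) :=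
    cylinderForm_tangentPair gN ε
  have hchart : ∀ p : interval δ × N,
      inChart g p =ᶠ[𝓝 ((p.1 : ℝ), extChartAt 𝓘(ℝ, E) p.2 p.2)] cyl (familyInChart gN ε p.2) :=
    fun p ↦ chartExpr_cylinderForm gN ε p
  have hricci : ∀ (p : interval δ × N) (X Y : ℝ × E), ricci g p X Y =
      coordRicci (cyl (familyInChart gN ε p.2)) ((p.1 : ℝ), extChartAt 𝓘(ℝ, E) p.2 p.2) X Y := by
    intro p X Y
    change coordRicci (inChart g p) (extChartAt (𝓘(ℝ, ℝ).prod 𝓘(ℝ, E)) p p) X Y = _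
    rw [extChartAt_cylinder, coordRicci_congr (hchart p)]
  refine ⟨δ, hδ, g, fun s ↦ familyMetric gN ε s (hpos s), hcyl, fun p X hX ↦ ?_,
    fun x u v ↦ ?_, ?_, fun x ↦ ?_⟩
  · exact (hricci p X X).symm ▸ (h (hs p.1) p.2).2 X hX
  · have hg := isMetricAt_inChart gN x
    rw [sliceII_eq_christoffel_fst hcyl, extChartAt_cylinder, christoffel_congr (hchart _)]
    exact christoffel_cyl_quadFamily_fst hg.contDiffAt (contDiffAt_correctedRicci gN ε x)
      hg.isInvertible u v
  · have hinner : (familyMetric gN ε (origin hδ) (hpos (origin hδ))).inner = gN.inner := by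
      funext x
      ext u v
      refine (familyForm_apply gN ε 0 x u v).trans ?_
      simp
    rw [Bundle.ContMDiffRiemannianMetric.mk.injEq]
    exact hinner
  · have h1 := coordRicci_familyInChart gN ε hE x 1 0
    have h0 : gN.inner x (0 : E) (0 : E) = 0 := map_zero _
    rw [h0, one_pow, one_mul, mul_zero, add_zero] at h1
    exact (hricci (origin hδ, x) (1, 0) (1, 0)).trans h1

end Construction
end CylinderRicci

end

theorem lemma2p1 {E : Type*} [NormedAddCommGroup E] [NormedSpace ℝ E] [FiniteDimensional ℝ E]
    (hE : 1 ≤ Module.finrank ℝ E)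
    {N : Type*} [TopologicalSpace N] [T2Space N] [CompactSpace N] [ChartedSpace E N]
    [IsManifold 𝓘(ℝ, E) ∞ N] (gN : CylinderRicci.Metric 𝓘(ℝ, E) N) :
    (∀ ε : ℝ, 0 < ε → ∃ (δ : ℝ) (hδ : 0 < δ) (g : CylinderRicci.CylinderMetric E δ N)
        (gt : CylinderRicci.interval δ → CylinderRicci.Metric 𝓘(ℝ, E) N),
        CylinderRicci.IsCylindrical g gt ∧
        CylinderRicci.PositiveRicci g ∧
        CylinderRicci.SliceTotallyGeodesic g (CylinderRicci.origin hδ) ∧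
        gt (CylinderRicci.origin hδ) = gN ∧
        ∀ x : N, CylinderRicci.ricci g (CylinderRicci.origin hδ, x)
          (CylinderRicci.partialT (CylinderRicci.origin hδ, x))
          (CylinderRicci.partialT (CylinderRicci.origin hδ, x)) = ε) ↔
      ∀ x : N, 0 ≤ CylinderRicci.scal gN x := by
  refine ⟨fun h x ↦ le_of_forall_pos_le_add fun ε hε ↦ ?_, fun h ε hε ↦
    CylinderRicci.exists_cylinder_of_scal_nonneg gN ε hE h hε⟩
  obtain ⟨δ, hδ, g, gt, hg, hpos, hgeod, ht, hr⟩ := h ε hε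
  exact CylinderRicci.neg_le_scal_of_cylinder _ hg hpos hgeod ht x (hr x)
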